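/- Let $G$ be a locally compact (Hausdorff) group with left Haar measure, and let $L^1(G)$ be its group algebra, that is, the Banach algebra of complex integrable functions on $G$ (modulo equality almost everywhere) with the convolution product $(f*g)(x)=\int_G f(y)\,g(y^{-1}x)\,dy$. Then $L^1(G)$ is symmetrically pseudo-amenable if and only if $G$ is amenable. Here a complex Banach algebra $A$ is called \emph{symmetrically pseudo-amenable} if there is a (not necessarily bounded) net $(t_\lambda)_{\lambda\in\Lambda}$ in the projective tensor product $A\widehat{\otimes}A$ such that $t_\lambda^{\circ}=t_\lambda$ for all $\lambda$, and, for all $a\in A$, $a\,t_\lambda-t_\lambda\,a\to 0$ and $\pi(t_\lambda)\,a\to a$ in norm, where the flip $t\mapsto t^\circ$, the module actions and $\pi$ are the continuous linear maps determined by $(b\otimes c)^{\circ}=c\otimes b$, $a(b\otimes c)=ab\otimes c$, $(b\otimes c)a=b\otimes ca$ and $\pi(b\otimes c)=bc$. The group $G$ is called \emph{amenable} if there is a left invariant mean on $L^\infty(G)$, that is, a positive linear functional $m$ on $L^\infty(G)$ with $m(1)=1$ and $m(L_xf)=m(f)$ for all $x\in G$ and $f\in L^\infty(G)$, where $(L_xf)(y)=f(x^{-1}y)$.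 -/

import Mathlib

open MeasureTheory Filter Topology
open scoped ENNReal TensorProduct

noncomputable section

/-! ### The projective tensor square of a Banach algebra -/

section ProjectiveTensor

variable (A : Type*) [NonUnitalNormedRing A] [NormedSpace ℂ A]

/-- The projective tensor product `A ⊗̂ A`: the completion of the algebraic tensor product
`A ⊗ A` over `ℂ` with respect to the projective norm
`‖t‖ = inf {∑ ‖aᵢ‖ ‖bᵢ‖ : t = ∑ aᵢ ⊗ bᵢ}`, which is Mathlib's norm on `⨂[ℂ] i, E i`. -/
abbrev ProjTensorSq : Type _ := UniformSpace.Completion (⨂[ℂ] _ : Fin 2, A)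

variable {A}

/-- The elementary tensor `a ⊗ b` in `A ⊗̂ A`. -/
def ProjTensorSq.tmul (a b : A) : ProjTensorSq A :=
  ((PiTensorProduct.tprod ℂ (![a, b] : Fin 2 → A) : ⨂[ℂ] _ : Fin 2, A) : ProjTensorSq A)

/-- The flip map `t ↦ t°` of `A ⊗̂ A`, the continuous linear map with `(a ⊗ b)° = b ⊗ a`. -/
def ProjTensorSq.flip : ProjTensorSq A →L[ℂ] ProjTensorSq A :=
  (PiTensorProduct.liftIsometry ℂ (fun _ : Fin 2 => A) (⨂[ℂ] _ : Fin 2, A)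
    ((PiTensorProduct.tprodL ℂ).domDomCongr (Equiv.swap (0 : Fin 2) 1))).completion

theorem ProjTensorSq.flip_tmul (a b : A) :
    ProjTensorSq.flip (ProjTensorSq.tmul a b) = ProjTensorSq.tmul b a := by
  have h : (fun i => (![a, b] : Fin 2 → A) (Equiv.swap (0 : Fin 2) 1 i)) = ![b, a] := by
    funext i; fin_cases i <;> simp
  simp only [ProjTensorSq.flip, ProjTensorSq.tmul, ContinuousLinearMap.completion_apply_coe]
  congr 1
  simp [h]

variable [IsScalarTower ℂ A A] [SMulCommClass ℂ A A]

/-- The left action on `A ⊗̂ A`, the continuous linear map with `a (b ⊗ c) = ab ⊗ c`. -/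
def ProjTensorSq.leftMul (a : A) : ProjTensorSq A →L[ℂ] ProjTensorSq A :=
  (PiTensorProduct.mapL
    (![ContinuousLinearMap.mul ℂ A a, ContinuousLinearMap.id ℂ A] :
      Fin 2 → (A →L[ℂ] A))).completion

theorem ProjTensorSq.leftMul_tmul (a b c : A) :
    ProjTensorSq.leftMul a (ProjTensorSq.tmul b c) = ProjTensorSq.tmul (a * b) c := by
  simp only [ProjTensorSq.leftMul, ProjTensorSq.tmul, ContinuousLinearMap.completion_apply_coe]
  congr 1
  simp only [PiTensorProduct.mapL_apply, PiTensorProduct.map_tprod]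
  congr 1
  funext i; fin_cases i <;> simp

/-- The right action on `A ⊗̂ A`, the continuous linear map with `(b ⊗ c) a = b ⊗ ca`. -/
def ProjTensorSq.rightMul (a : A) : ProjTensorSq A →L[ℂ] ProjTensorSq A :=
  (PiTensorProduct.mapL
    (![ContinuousLinearMap.id ℂ A, (ContinuousLinearMap.mul ℂ A).flip a] :
      Fin 2 → (A →L[ℂ] A))).completion

theorem ProjTensorSq.rightMul_tmul (a b c : A) :
    ProjTensorSq.rightMul a (ProjTensorSq.tmul b c) = ProjTensorSq.tmul b (c * a) := by
  simp only [ProjTensorSq.rightMul, ProjTensorSq.tmul, ContinuousLinearMap.completion_apply_coe]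
  congr 1
  simp only [PiTensorProduct.mapL_apply, PiTensorProduct.map_tprod]
  congr 1
  funext i; fin_cases i <;> simp

variable (A) in
/-- The product of `A` as a continuous multilinear map `(m₀, m₁) ↦ m₀ m₁`. -/
def mulMultilinear : ContinuousMultilinearMap ℂ (fun _ : Fin 2 => A) A :=
  MultilinearMap.mkContinuous
    { toFun := fun m => m 0 * m 1
      map_update_add' := by
        intro _ m i x y
        fin_cases i <;> simp [Function.update, add_mul, mul_add]
      map_update_smul' := by
        intro _ m i c x
        fin_cases i <;> simp [Function.update, smul_mul_assoc, mul_smul_comm] }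
    1 (fun m => by simpa using norm_mul_le (m 0) (m 1))

/-- The product morphism `π : A ⊗̂ A → A`, the continuous linear map with `π (a ⊗ b) = ab`. -/
def ProjTensorSq.prod [CompleteSpace A] : ProjTensorSq A →L[ℂ] A :=
  (PiTensorProduct.liftIsometry ℂ (fun _ : Fin 2 => A) A (mulMultilinear A)).fromCompletion

theorem ProjTensorSq.prod_tmul [CompleteSpace A] (a b : A) :
    ProjTensorSq.prod (ProjTensorSq.tmul a b) = a * b := by
  simp [ProjTensorSq.prod, ProjTensorSq.tmul, mulMultilinear]

end ProjectiveTensor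

/-! ### Symmetric pseudo-amenability -/

section PseudoAmenable

variable {A : Type*} [NonUnitalNormedRing A] [NormedSpace ℂ A] [IsScalarTower ℂ A A]
  [SMulCommClass ℂ A A] [CompleteSpace A]

/-- A net `t` in `A ⊗̂ A` is an approximate diagonal if `a t_λ - t_λ a → 0` and
`π(t_λ) a → a` for all `a`. No boundedness is required. -/
def IsApproximateDiagonal {Λ : Type*} [Preorder Λ] (t : Λ → ProjTensorSq A) : Prop :=
  ∀ a : A,
    Tendsto (fun i => ProjTensorSq.leftMul a (t i) - ProjTensorSq.rightMul a (t i)) atTop (𝓝 0) ∧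
    Tendsto (fun i => ProjTensorSq.prod (t i) * a) atTop (𝓝 a)

/-- A Banach algebra is symmetrically pseudo-amenable if it has an approximate diagonal (a net
over a nonempty directed set) consisting of symmetric elements. -/
def IsSymmetricallyPseudoAmenable.{u} (A : Type u) [NonUnitalNormedRing A] [NormedSpace ℂ A]
    [IsScalarTower ℂ A A] [SMulCommClass ℂ A A] [CompleteSpace A] : Prop :=
  ∃ (Λ : Type u) (_ : Preorder Λ) (_ : Nonempty Λ) (_ : IsDirected Λ (· ≤ ·))
    (t : Λ → ProjTensorSq A),
    IsApproximateDiagonal t ∧ ∀ i, ProjTensorSq.flip (t i) = t i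

end PseudoAmenable

/-! ### The group algebra `L¹(G)` -/

section GroupAlgebra


variable {G : Type*} [Group G] [TopologicalSpace G] [IsTopologicalGroup G]
  [MeasurableSpace G] [BorelSpace G] {μ : Measure G}

/-- Left translation on `L¹(G)`: `(L_y g)(x) = g (y⁻¹ x)`. -/
def leftTranslate [μ.IsMulLeftInvariant] (y : G) (g : Lp ℂ 1 μ) : Lp ℂ 1 μ :=
  Lp.compMeasurePreserving (fun x => y⁻¹ * x) (measurePreserving_mul_left μ y⁻¹) g

/-- Convolution on `L¹(G)`, `(f * g)(x) = ∫ f(y) g(y⁻¹ x) dy`, as the `L¹(G)`-valued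
Bochner integral `f * g = ∫ f(y) • L_y g dy`. -/
def l1Conv [μ.IsMulLeftInvariant] (f g : Lp ℂ 1 μ) : Lp ℂ 1 μ :=
  ∫ y, (f y) • leftTranslate y g ∂μ

section Translate

variable [μ.IsMulLeftInvariant]

theorem norm_leftTranslate (y : G) (g : Lp ℂ 1 μ) : ‖leftTranslate y g‖ = ‖g‖ :=
  Lp.norm_compMeasurePreserving g _

theorem leftTranslate_add (y : G) (g h : Lp ℂ 1 μ) :
    leftTranslate y (g + h) = leftTranslate y g + leftTranslate y h :=
  map_add _ _ _

theorem leftTranslate_smul (y : G) (c : ℂ) (g : Lp ℂ 1 μ) :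
    leftTranslate y (c • g) = c • leftTranslate y g :=
  (Lp.compMeasurePreservingₗ ℂ _ (measurePreserving_mul_left μ y⁻¹)).map_smul c g

theorem leftTranslate_mul (y z : G) (g : Lp ℂ 1 μ) :
    leftTranslate (y * z) g = leftTranslate y (leftTranslate z g) := by
  have h := mul_smul (DomMulAct.mk y⁻¹) (DomMulAct.mk z⁻¹) g
  rw [← DomMulAct.mk_mul, ← mul_inv_rev] at h
  exact h

variable (μ) in
/-- Left translation as a continuous linear map. -/
def leftTranslateL (y : G) : Lp ℂ 1 μ →L[ℂ] Lp ℂ 1 μ :=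
  (Lp.compMeasurePreservingₗᵢ ℂ _ (measurePreserving_mul_left μ y⁻¹)).toContinuousLinearMap

theorem leftTranslateL_apply (y : G) (g : Lp ℂ 1 μ) :
    leftTranslateL μ y g = leftTranslate y g := rfl

theorem coeFn_leftTranslate (y : G) (g : Lp ℂ 1 μ) :
    leftTranslate y g =ᵐ[μ] fun x => g (y⁻¹ * x) :=
  Lp.coeFn_compMeasurePreserving g _

end Translate

variable [LocallyCompactSpace G] [T2Space G] [μ.IsHaarMeasure] [μ.Regular]

theorem continuous_leftTranslate (g : Lp ℂ 1 μ) : Continuous fun y : G => leftTranslate y g := by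
  have : Fact ((1 : ℝ≥0∞) ≠ ∞) := ⟨ENNReal.one_ne_top⟩
  have h : Continuous fun y : G => DomMulAct.mk y⁻¹ • g :=
    (DomMulAct.continuous_mk.comp continuous_inv).smul continuous_const
  exact h

theorem aestronglyMeasurable_restrict_of_continuous {E : Type*} [NormedAddCommGroup E]
    {φ : G → E} (hφ : Continuous φ) {s : Set G} (hs : MeasurableSet s) (hμs : μ s ≠ ∞) :
    AEStronglyMeasurable φ (μ.restrict s) := by
  have hK : ∀ n : ℕ, ∃ K ⊆ s, IsCompact K ∧ μ (s \ K) < ((n : ℝ≥0∞) + 1)⁻¹ := fun n =>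
    hs.exists_isCompact_sdiff_lt hμs (by simp)
  choose K hK1 hK2 hK3 using hK
  have hT : AEStronglyMeasurable φ (μ.restrict (⋃ n, K n)) :=
    aestronglyMeasurable_iUnion_iff.2 fun n =>
      hφ.continuousOn.aestronglyMeasurable_of_isCompact (hK2 n) (hK2 n).measurableSet
  have h0 : Tendsto (fun n : ℕ => ((n : ℝ≥0∞) + 1)⁻¹) atTop (𝓝 0) := by
    have := (tendsto_add_atTop_iff_nat 1).2 ENNReal.tendsto_inv_nat_nhds_zero
    simpa using this
  have hN : AEStronglyMeasurable φ (μ.restrict (s \ ⋃ n, K n)) := by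
    have hz : μ (s \ ⋃ n, K n) = 0 := by
      refine le_antisymm (ge_of_tendsto' h0 fun n => ?_) zero_le
      exact (measure_mono (Set.sdiff_subset_sdiff_right (Set.subset_iUnion K n))).trans (hK3 n).le
    rw [Measure.restrict_eq_zero.2 hz]
    exact aestronglyMeasurable_zero_measure φ
  refine (aestronglyMeasurable_union_iff.2 ⟨hT, hN⟩).mono_measure
    (Measure.restrict_mono ?_ le_rfl)
  intro x hx
  by_cases h : x ∈ ⋃ n, K n
  · exact Or.inl h
  · exact Or.inr ⟨hx, h⟩

theorem integrable_smul_leftTranslate (f g : Lp ℂ 1 μ) :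
    Integrable (fun y => (f y) • leftTranslate y g) μ := by
  have hf : Integrable f μ := L1.integrable_coeFn f
  have hc := continuous_leftTranslate g
  have hfin := hf.aefinStronglyMeasurable
  have ht := hfin.measurableSet
  have hzero := hfin.ae_eq_zero_compl
  have hsf := hfin.sigmaFinite_restrict
  generalize hfin.sigmaFiniteSet = t at ht hzero hsf
  have h1 : AEStronglyMeasurable (fun y => leftTranslate y g) (μ.restrict t) := by
    have hcov : t = ⋃ n, spanningSets (μ.restrict t) n ∩ t := by
      rw [← Set.iUnion_inter, iUnion_spanningSets, Set.univ_inter]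
    rw [hcov]
    refine aestronglyMeasurable_iUnion_iff.2 fun n => ?_
    have hm := measurableSet_spanningSets (μ.restrict t) n
    refine aestronglyMeasurable_restrict_of_continuous hc (hm.inter ht) ?_
    rw [← Measure.restrict_apply hm]
    exact (measure_spanningSets_lt_top (μ.restrict t) n).ne
  have hmeas : AEStronglyMeasurable (fun y => (f y) • leftTranslate y g) μ := by
    suffices h : AEStronglyMeasurable (fun y => (f y) • leftTranslate y g)
        (μ.restrict (t ∪ tᶜ)) by
      rwa [Set.union_compl_self, Measure.restrict_univ] at h
    refine aestronglyMeasurable_union_iff.2 ⟨hf.1.restrict.smul h1, ?_⟩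
    refine (aestronglyMeasurable_zero (β := Lp ℂ 1 μ)).congr ?_
    filter_upwards [hzero] with y hy
    simp [hy]
  refine (hf.norm.mul_const ‖g‖).mono' hmeas (ae_of_all _ fun y => ?_)
  rw [norm_smul, norm_leftTranslate]

theorem norm_conv_le (f g : Lp ℂ 1 μ) : ‖l1Conv f g‖ ≤ ‖f‖ * ‖g‖ := by
  refine (norm_integral_le_integral_norm _).trans_eq ?_
  simp_rw [norm_smul, norm_leftTranslate]
  rw [integral_mul_const, L1.norm_eq_integral_norm f]

theorem add_conv (f₁ f₂ g : Lp ℂ 1 μ) : l1Conv (f₁ + f₂) g = l1Conv f₁ g + l1Conv f₂ g := by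
  unfold l1Conv
  rw [← integral_add (integrable_smul_leftTranslate f₁ g) (integrable_smul_leftTranslate f₂ g)]
  refine integral_congr_ae ?_
  filter_upwards [Lp.coeFn_add f₁ f₂] with y hy
  rw [hy, Pi.add_apply, add_smul]

theorem conv_add (f g₁ g₂ : Lp ℂ 1 μ) : l1Conv f (g₁ + g₂) = l1Conv f g₁ + l1Conv f g₂ := by
  unfold l1Conv
  rw [← integral_add (integrable_smul_leftTranslate f g₁) (integrable_smul_leftTranslate f g₂)]
  simp_rw [leftTranslate_add, smul_add]

theorem smul_conv (c : ℂ) (f g : Lp ℂ 1 μ) : l1Conv (c • f) g = c • l1Conv f g := by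
  unfold l1Conv
  rw [← integral_smul]
  refine integral_congr_ae ?_
  filter_upwards [Lp.coeFn_smul c f] with y hy
  rw [hy, Pi.smul_apply, smul_assoc]

theorem conv_smul (c : ℂ) (f g : Lp ℂ 1 μ) : l1Conv f (c • g) = c • l1Conv f g := by
  unfold l1Conv
  rw [← integral_smul]
  simp_rw [leftTranslate_smul, smul_comm c]

theorem conv_leftTranslate (y : G) (f g : Lp ℂ 1 μ) :
    l1Conv (leftTranslate y f) g = leftTranslate y (l1Conv f g) := by
  unfold l1Conv
  rw [← leftTranslateL_apply y (∫ z, f z • leftTranslate z g ∂μ),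
    ← ContinuousLinearMap.integral_comp_comm _
    (integrable_smul_leftTranslate f g),
    ← integral_mul_left_eq_self (fun x => (leftTranslate y f) x • leftTranslate x g) y]
  refine integral_congr_ae ?_
  have h := (measurePreserving_mul_left μ y).quasiMeasurePreserving.ae (coeFn_leftTranslate y f)
  filter_upwards [h] with x hx
  rw [hx, map_smul, leftTranslateL_apply, leftTranslate_mul, inv_mul_cancel_left]

/-- Right convolution by `h` as a continuous linear map. -/
def convRightL (h : Lp ℂ 1 μ) : Lp ℂ 1 μ →L[ℂ] Lp ℂ 1 μ :=
  LinearMap.mkContinuous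
    { toFun := fun f => l1Conv f h
      map_add' := fun f₁ f₂ => add_conv f₁ f₂ h
      map_smul' := fun c f => smul_conv c f h } ‖h‖
    (fun f => (norm_conv_le f h).trans_eq (mul_comm _ _))

theorem conv_assoc (f g h : Lp ℂ 1 μ) : l1Conv (l1Conv f g) h = l1Conv f (l1Conv g h) := by
  change convRightL h (∫ y, (f y) • leftTranslate y g ∂μ) = _
  rw [← ContinuousLinearMap.integral_comp_comm _ (integrable_smul_leftTranslate f g)]
  refine integral_congr_ae (ae_of_all _ fun y => ?_)
  change convRightL h (f y • leftTranslate y g) = f y • leftTranslate y (l1Conv g h)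
  rw [map_smul, ← conv_leftTranslate]
  rfl

end GroupAlgebra

/-- The underlying Banach space of the group algebra `L¹(G)` of a locally compact group `G` with
left Haar measure `μ`: complex integrable functions modulo equality almost everywhere. Below it
is given the convolution product. -/
def GroupL1 (G : Type*) [MeasurableSpace G] (μ : Measure G) : Type _ := Lp ℂ 1 μ

namespace GroupL1

variable {G : Type*} [MeasurableSpace G] {μ : Measure G}

instance : NormedAddCommGroup (GroupL1 G μ) := inferInstanceAs (NormedAddCommGroup (Lp ℂ 1 μ))

instance : NormedSpace ℂ (GroupL1 G μ) := inferInstanceAs (NormedSpace ℂ (Lp ℂ 1 μ))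

instance : CompleteSpace (GroupL1 G μ) := inferInstanceAs (CompleteSpace (Lp ℂ 1 μ))

variable [Group G] [TopologicalSpace G] [IsTopologicalGroup G] [BorelSpace G]
  [LocallyCompactSpace G] [T2Space G] [μ.IsHaarMeasure] [μ.Regular]

instance : NonUnitalNormedRing (GroupL1 G μ) :=
  { (inferInstance : NormedAddCommGroup (GroupL1 G μ)) with
    mul := fun f g => l1Conv (μ := μ) f g
    left_distrib := fun f g h => conv_add (μ := μ) f g h
    right_distrib := fun f g h => add_conv (μ := μ) f g h
    zero_mul := fun f => by
      have h := smul_conv (μ := μ) 0 0 f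
      simp only [zero_smul] at h
      exact h
    mul_zero := fun f => by
      have h := conv_smul (μ := μ) 0 f 0
      simp only [zero_smul] at h
      exact h
    mul_assoc := fun f g h => conv_assoc (μ := μ) f g h
    norm_mul_le := fun f g => norm_conv_le (μ := μ) f g }

instance : IsScalarTower ℂ (GroupL1 G μ) (GroupL1 G μ) :=
  ⟨fun c f g => smul_conv (μ := μ) c f g⟩

instance : SMulCommClass ℂ (GroupL1 G μ) (GroupL1 G μ) :=
  ⟨fun c f g => (conv_smul (μ := μ) c f g).symm⟩

end GroupL1

/-! ### Amenable locally compact groups -/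

section AmenableGroup

variable {G : Type*} [TopologicalSpace G] [MeasurableSpace G]

/-- The real functions on `G` that represent elements of `L^∞(G)`: those that are locally
measurable (measurable on every compact set) and locally essentially bounded by a constant.
`L^∞(G)` is the quotient of this space by the locally null functions. -/
def LInftyFun (μ : Measure G) : Submodule ℝ (G → ℝ) where
  carrier := {f | (∀ K : Set G, IsCompact K → AEMeasurable f (μ.restrict K)) ∧
    ∃ C : ℝ, ∀ K : Set G, IsCompact K → ∀ᵐ x ∂(μ.restrict K), |f x| ≤ C}
  add_mem' := by
    rintro f g ⟨hf, C, hC⟩ ⟨hg, D, hD⟩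
    refine ⟨fun K hK => (hf K hK).add (hg K hK), C + D, fun K hK => ?_⟩
    filter_upwards [hC K hK, hD K hK] with x h1 h2
    exact (abs_add_le _ _).trans (add_le_add h1 h2)
  zero_mem' := ⟨fun _ _ => aemeasurable_const, 0, fun _ _ => ae_of_all _ fun _ => by simp⟩
  smul_mem' := by
    rintro c f ⟨hf, C, hC⟩
    refine ⟨fun K hK => (hf K hK).const_smul c, |c| * C, fun K hK => ?_⟩
    filter_upwards [hC K hK] with x h1
    simpa [abs_mul] using mul_le_mul_of_nonneg_left h1 (abs_nonneg c)

/-- The constant function `1` as an element of `LInftyFun μ`. -/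
def LInftyFun.one (μ : Measure G) : LInftyFun μ :=
  ⟨fun _ => 1, fun _ _ => aemeasurable_const, 1, fun _ _ => ae_of_all _ fun _ => by simp⟩

variable [Group G] [IsTopologicalGroup G] [BorelSpace G]

/-- Left translation `(L_x f)(y) = f (x⁻¹ y)` on `LInftyFun μ`. -/
def LInftyFun.translate {μ : Measure G} [μ.IsMulLeftInvariant] (x : G) (f : LInftyFun μ) :
    LInftyFun μ :=
  ⟨fun y => f.1 (x⁻¹ * y), by
    have key : ∀ K : Set G, IsCompact K → IsCompact ((fun y => x⁻¹ * y) '' K) ∧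
        MeasurePreserving (fun y => x⁻¹ * y) (μ.restrict K)
          (μ.restrict ((fun y => x⁻¹ * y) '' K)) := by
      intro K hK
      refine ⟨hK.image (continuous_const_mul x⁻¹), ?_⟩
      exact (measurePreserving_mul_left μ x⁻¹).restrict_image_emb
        (measurableEmbedding_mulLeft x⁻¹) K
    obtain ⟨hf, C, hC⟩ := f.2
    refine ⟨fun K hK => ?_, C, fun K hK => ?_⟩
    · exact (hf _ (key K hK).1).comp_quasiMeasurePreserving (key K hK).2.quasiMeasurePreserving
    · exact (key K hK).2.quasiMeasurePreserving.ae (hC _ (key K hK).1)⟩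

/-- A locally compact group `G` (with left Haar measure `μ`) is amenable if there is a left
invariant mean on `L^∞(G)`: a linear functional `m` with `m 1 = 1`, with `m f ≥ 0` whenever
`f ≥ 0` locally almost everywhere, and with `m (L_x f) = m f`. Positivity makes `m` vanish on
locally null functions, so that it is a functional on the quotient `L^∞(G)`, and makes it
bounded of norm `1`. -/
def IsAmenableGroup (G : Type*) [Group G] [TopologicalSpace G] [IsTopologicalGroup G]
    [MeasurableSpace G] [BorelSpace G] (μ : Measure G) [μ.IsMulLeftInvariant] : Prop :=
  ∃ m : LInftyFun μ →ₗ[ℝ] ℝ,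
    m (LInftyFun.one μ) = 1 ∧
    (∀ f : LInftyFun μ,
      (∀ K : Set G, IsCompact K → ∀ᵐ x ∂(μ.restrict K), 0 ≤ f.1 x) → 0 ≤ m f) ∧
    ∀ (x : G) (f : LInftyFun μ), m (LInftyFun.translate x f) = m f

end AmenableGroup

end

/-!
Suppose `G` is amenable. Averaging the functions `x ↦ ψ (b * L_x e)` by an invariant mean shows,
through Hahn–Banach, that `0` lies in the closed convex set spanned by the tuples `(bᵢ * g)ᵢ`, where
`g` runs over the probability densities and the `bᵢ` have integral zero; hence there are densities
`f` with `∫ |a(w)| ‖L_w f - f‖ dw` as small as we like. For such an `f` and an element `u` of a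
contractive approximate unit, put

  `t = ∬ f(z) f(y) (δ_z * u * δ_{y⁻¹}) ⊗ (δ_y * u * δ_{z⁻¹}) dy dz`.

The flip exchanges the roles of `y` and `z`, so `t° = t`. A left translation of the first factor by
`w` can be moved to a right translation of the second at the cost of replacing `f` by `L_w f` in the
outer average, so `a t - t a` is small whatever `u` is. The inner average does not affect the
product, so `π(t)` is the average of `δ_z * u * u * δ_{z⁻¹}`, and `u` is chosen after `f` to make
`π(t) a - a` small.

Conversely, let `t` run through an approximate diagonal. Slicing `b ⊗ c ↦ (∫ c) b` turns it into a
net `f` in `L¹(G)` with `a * f - (∫ a) f → 0` and `∫ f → 1`. Then `L_x f - f → 0`, and a weak-star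
cluster point of the means with densities `|f| / ‖f‖` is left invariant.
-/

noncomputable section

/-! ### Integrable functions on a space with a regular measure -/

section RegularMeasure

variable {X : Type*} [TopologicalSpace X] [T2Space X] [LocallyCompactSpace X]
  [MeasurableSpace X] [BorelSpace X] {μ : Measure X} [μ.Regular]
  {F : Type*} [NormedAddCommGroup F] [NormedSpace ℝ F]

theorem exists_continuous_abs_sub_indicator_le {t : Set X} (ht : MeasurableSet t)
    (htμ : μ t ≠ ∞) {η : ℝ≥0∞} (hη : η ≠ 0) :
    ∃ (s : Set X) (φ : X → ℝ), MeasurableSet s ∧ μ s ≤ η ∧ Continuous φ ∧ HasCompactSupport φ ∧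
      ∀ x, |φ x - t.indicator 1 x| ≤ s.indicator 1 x := by
  have hη' : η / 2 ≠ 0 := (ENNReal.half_pos hη).ne'
  obtain ⟨K, hKt, hK, hμK⟩ := ht.exists_isCompact_sdiff_lt htμ hη'
  obtain ⟨V, htV, hV, -, hμV⟩ := ht.exists_isOpen_sdiff_lt htμ hη'
  obtain ⟨φ, hφ1, hφ0, hφc, hφ01⟩ := exists_continuous_one_zero_of_isCompact hK
    hV.isClosed_compl (Set.disjoint_compl_right_iff_subset.2 (hKt.trans htV))
  refine ⟨V \ K, φ, hV.measurableSet.diff hK.measurableSet, ?_, φ.continuous, hφc, fun x => ?_⟩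
  · calc μ (V \ K) ≤ μ (V \ t ∪ t \ K) := measure_mono fun x hx => by
          by_cases hxt : x ∈ t
          exacts [Or.inr ⟨hxt, hx.2⟩, Or.inl ⟨hx.1, hxt⟩]
      _ ≤ η / 2 + η / 2 := (measure_union_le _ _).trans (add_le_add hμV.le hμK.le)
      _ = η := ENNReal.add_halves η
  · have h01 := hφ01 x
    by_cases hxK : x ∈ K
    · simp [hxK, hKt hxK, hφ1 hxK]
    by_cases hxV : x ∈ V
    · rw [Set.indicator_of_mem (show x ∈ V \ K from ⟨hxV, hxK⟩), Pi.one_apply, abs_le]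
      by_cases hxt : x ∈ t <;> simp only [hxt, Set.indicator_of_mem, Set.indicator_of_notMem,
        not_false_eq_true, Pi.one_apply] <;> constructor <;> linarith [h01.1, h01.2]
    · have hxt : x ∉ t := fun h => hxV (htV h)
      simp [hxV, hxt, hφ0 (show x ∈ Vᶜ from hxV)]

theorem exists_continuous_hasCompactSupport_integral_norm_sub_le {f : X → F}
    (hf : Integrable f μ) {ε : ℝ} (hε : 0 < ε) :
    ∃ g : X → F, Continuous g ∧ HasCompactSupport g ∧ ∫ x, ‖f x - g x‖ ∂μ ≤ ε := by
  have approx_indicator : ∀ (c : F) ⦃t : Set X⦄, MeasurableSet t → μ t < ∞ → ∀ {δ : ℝ≥0∞},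
      δ ≠ 0 → ∃ g : X → F, eLpNorm (g - t.indicator fun _ => c) 1 μ ≤ δ ∧
        (Continuous g ∧ HasCompactSupport g) := by
    intro c t ht htμ δ hδ
    obtain ⟨η, hη, hηc⟩ := exists_eLpNorm_indicator_le (μ := μ) ENNReal.one_ne_top c hδ
    obtain ⟨s, φ, -, hs, hφ, hφc, hφt⟩ :=
      exists_continuous_abs_sub_indicator_le ht htμ.ne (ENNReal.coe_ne_zero.2 hη.ne')
    refine ⟨fun x => φ x • c, (eLpNorm_mono fun x => ?_).trans (hηc s hs), by fun_prop,
      hφc.smul_right⟩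
    have h : φ x • c - t.indicator (fun _ => c) x = (φ x - t.indicator 1 x) • c := by
      by_cases hx : x ∈ t <;> simp [hx, sub_smul]
    rw [Pi.sub_apply, h, norm_smul, Real.norm_eq_abs]
    refine (mul_le_mul_of_nonneg_right (hφt x) (norm_nonneg c)).trans_eq ?_
    by_cases hx : x ∈ s <;> simp [hx]
  obtain ⟨g, hfg, hg, hgs⟩ := (memLp_one_iff_integrable.2 hf).induction_dense ENNReal.one_ne_top
    (fun g => Continuous g ∧ HasCompactSupport g) approx_indicator
    (fun f g hf hg => ⟨hf.1.add hg.1, HasCompactSupport.add hf.2 hg.2⟩)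
    (fun f hf => (hf.1.integrable_of_hasCompactSupport (μ := μ) hf.2).aestronglyMeasurable)
    (ENNReal.ofReal_pos.2 hε).ne'
  refine ⟨g, hg, hgs, ?_⟩
  rw [eLpNorm_one_eq_lintegral_enorm] at hfg
  change ∫ x, ‖(f - g) x‖ ∂μ ≤ ε
  rw [integral_norm_eq_lintegral_enorm
    (hf.sub (hg.integrable_of_hasCompactSupport hgs)).aestronglyMeasurable]
  exact ENNReal.toReal_le_of_le_ofReal hε.le hfg

theorem ae_eq_zero_of_forall_integral_continuous_smul_eq_zero [CompleteSpace F] {f : X → F}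
    (hf : Integrable f μ)
    (h : ∀ φ : X → ℝ, Continuous φ → HasCompactSupport φ → ∫ x, φ x • f x ∂μ = 0) :
    f =ᵐ[μ] 0 := by
  refine hf.ae_eq_zero_of_forall_setIntegral_eq_zero fun t ht htμ => norm_le_zero_iff.1 <|
    le_of_forall_pos_le_add fun ε hε => ?_
  obtain ⟨δ, hδ, hδf⟩ := exists_pos_setLIntegral_lt_of_measure_lt hf.2.ne
    (ENNReal.ofReal_pos.2 hε).ne'
  obtain ⟨η, hη, hηδ⟩ := exists_between hδ
  obtain ⟨s, φ, hs, hsη, hφ, hφc, hφt⟩ :=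
    exists_continuous_abs_sub_indicator_le ht htμ.ne hη.ne'
  have hφf : Integrable (fun x => φ x • f x) μ := by
    obtain ⟨C, hC⟩ := hφc.exists_bound_of_continuous hφ
    exact hf.bdd_smul C (hφ.integrable_of_hasCompactSupport hφc).aestronglyMeasurable
      (ae_of_all _ hC)
  have pointwise : ∀ x, ‖t.indicator f x - φ x • f x‖ ≤ s.indicator (fun x => ‖f x‖) x := by
    intro x
    have h : t.indicator f x - φ x • f x = -((φ x - t.indicator 1 x) • f x) := by
      by_cases hx : x ∈ t <;> simp [hx, sub_smul]
    rw [h, norm_neg, norm_smul, Real.norm_eq_abs]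
    refine (mul_le_mul_of_nonneg_right (hφt x) (norm_nonneg (f x))).trans_eq ?_
    by_cases hx : x ∈ s <;> simp [hx]
  calc ‖∫ x in t, f x ∂μ‖ = ‖∫ x, (t.indicator f x - φ x • f x) ∂μ‖ := by
        rw [integral_sub (hf.indicator ht) hφf, h φ hφ hφc, sub_zero, integral_indicator ht]
    _ ≤ ∫ x, s.indicator (fun x => ‖f x‖) x ∂μ :=
        norm_integral_le_of_norm_le (hf.norm.indicator hs) (ae_of_all _ pointwise)
    _ ≤ 0 + ε := by
        rw [integral_indicator hs, integral_norm_eq_lintegral_enorm hf.1.restrict, zero_add]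
        exact ENNReal.toReal_le_of_le_ofReal hε.le (hδf s (hsη.trans_lt hηδ)).le

theorem exists_isCompact_setIntegral_compl_norm_le {f : X → F} (hf : Integrable f μ) {ε : ℝ}
    (hε : 0 < ε) : ∃ K : Set X, IsCompact K ∧ ∫ x in Kᶜ, ‖f x‖ ∂μ ≤ ε := by
  obtain ⟨g, hg, hgs, hfg⟩ := exists_continuous_hasCompactSupport_integral_norm_sub_le hf hε
  refine ⟨tsupport g, hgs, ?_⟩
  calc ∫ x in (tsupport g)ᶜ, ‖f x‖ ∂μ = ∫ x in (tsupport g)ᶜ, ‖f x - g x‖ ∂μ :=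
        setIntegral_congr_fun (isClosed_tsupport g).measurableSet.compl fun x hx => by
          simp [image_eq_zero_of_notMem_tsupport hx]
    _ ≤ ∫ x, ‖f x - g x‖ ∂μ := setIntegral_le_integral
        (hf.sub (hg.integrable_of_hasCompactSupport hgs)).norm (ae_of_all _ fun _ => norm_nonneg _)
    _ ≤ ε := hfg

theorem exists_isCompact_seq_ae_eq_zero {f : X → F} (hf : Integrable f μ) :
    ∃ K : ℕ → Set X, (∀ n, IsCompact (K n)) ∧ ∀ᵐ x ∂μ.restrict (⋃ n, K n)ᶜ, f x = 0 := by
  choose K hK hKf using fun n : ℕ =>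
    exists_isCompact_setIntegral_compl_norm_le hf (ε := 1 / ((n : ℝ) + 1)) (by positivity)
  refine ⟨K, hK, ?_⟩
  have hzero : ∫ x in (⋃ n, K n)ᶜ, ‖f x‖ ∂μ = 0 := by
    refine le_antisymm (ge_of_tendsto' tendsto_one_div_add_atTop_nhds_zero_nat fun n => ?_)
      (integral_nonneg fun x => norm_nonneg _)
    exact (setIntegral_mono_set hf.norm.integrableOn (ae_of_all _ fun x => norm_nonneg _)
      (Set.compl_subset_compl.2 (Set.subset_iUnion K n)).eventuallyLE).trans (hKf n)
  rw [integral_eq_zero_iff_of_nonneg (fun x => norm_nonneg _) hf.norm.integrableOn] at hzero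
  filter_upwards [hzero] with x hx using norm_eq_zero.1 hx

theorem ae_of_forall_isCompact_ae_restrict {f : X → F} (hf : Integrable f μ) {p : X → Prop}
    (hp : ∀ K : Set X, IsCompact K → ∀ᵐ x ∂μ.restrict K, p x) : ∀ᵐ x ∂μ, f x = 0 ∨ p x := by
  obtain ⟨K, hK, hfK⟩ := exists_isCompact_seq_ae_eq_zero hf
  have hS : MeasurableSet (⋃ n, K n) := .iUnion fun n => (hK n).measurableSet
  have hpS : ∀ᵐ x ∂μ.restrict (⋃ n, K n), p x := (ae_restrict_iUnion_iff _ _).2 fun n => hp _ (hK n)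
  filter_upwards [(ae_restrict_iff' hS).1 hpS, (ae_restrict_iff' hS.compl).1 hfK] with x hx hx'
  by_cases h : x ∈ ⋃ n, K n
  exacts [.inr (hx h), .inl (hx' h)]

theorem integrable_smul_of_ae_restrict_isCompact_bound {𝕜 E : Type*} [RCLike 𝕜]
    [NormedAddCommGroup E] [NormedSpace 𝕜 E] {f : X → 𝕜} (hf : Integrable f μ) {k : X → E}
    (hk : ∀ K : Set X, IsCompact K → AEStronglyMeasurable k (μ.restrict K)) {C : ℝ}
    (hC : ∀ K : Set X, IsCompact K → ∀ᵐ x ∂μ.restrict K, ‖k x‖ ≤ C) :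
    Integrable (fun x => f x • k x) μ := by
  obtain ⟨K, hK, hfK⟩ := exists_isCompact_seq_ae_eq_zero hf
  have on_union : IntegrableOn (fun x => f x • k x) (⋃ n, K n) μ :=
    hf.integrableOn.smul_bdd C (aestronglyMeasurable_iUnion_iff.2 fun n => hk _ (hK n))
      ((ae_restrict_iUnion_iff _ _).2 fun n => hC _ (hK n))
  have on_compl : IntegrableOn (fun x => f x • k x) (⋃ n, K n)ᶜ μ := by
    refine (integrableOn_zero (ε' := E)).congr ?_
    filter_upwards [hfK] with x hx using by simp [hx]
  rw [← integrableOn_univ, ← Set.union_compl_self (⋃ n, K n)]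
  exact on_union.union on_compl

theorem integrable_smul_of_continuous_of_norm_le {𝕜 E : Type*} [RCLike 𝕜] [NormedAddCommGroup E]
    [NormedSpace 𝕜 E] {f : X → 𝕜} (hf : Integrable f μ) {k : X → E} (hk : Continuous k) {C : ℝ}
    (hC : ∀ x, ‖k x‖ ≤ C) : Integrable (fun x => f x • k x) μ :=
  integrable_smul_of_ae_restrict_isCompact_bound hf
    (fun _ hK => hk.continuousOn.aestronglyMeasurable_of_isCompact hK hK.measurableSet)
    fun _ _ => ae_of_all _ hC

theorem l1_induction_of_hasCompactSupport {p : Lp F 1 μ → Prop} (hp : IsClosed {f | p f})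
    (h : ∀ (g : X → F) (hg : Continuous g) (hgs : HasCompactSupport g),
      p ((hg.integrable_of_hasCompactSupport hgs).toL1 g)) (f : Lp F 1 μ) : p f := by
  suffices hf : f ∈ closure {f | p f} by rwa [hp.closure_eq] at hf
  refine Metric.mem_closure_iff.2 fun ε hε => ?_
  obtain ⟨g, hg, hgs, hfg⟩ :=
    exists_continuous_hasCompactSupport_integral_norm_sub_le (L1.integrable_coeFn f) (half_pos hε)
  have hgi := hg.integrable_of_hasCompactSupport (μ := μ) hgs
  refine ⟨_, h g hg hgs, ?_⟩
  rw [dist_eq_norm, L1.norm_eq_integral_norm]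
  refine lt_of_le_of_lt (le_of_eq_of_le (integral_congr_ae ?_) hfg) (half_lt_self hε)
  filter_upwards [Lp.coeFn_sub f (hgi.toL1 g), hgi.coeFn_toL1] with x hsub hx
  rw [hsub, Pi.sub_apply, hx]

end RegularMeasure

section OperatorFamily

variable {X : Type*} [TopologicalSpace X] {𝕜 E F : Type*} [NontriviallyNormedField 𝕜]
  [NormedAddCommGroup E] [NormedSpace 𝕜 E] [NormedAddCommGroup F] [NormedSpace 𝕜 F]

theorem isClosed_setOf_continuous_apply {T : X → E →L[𝕜] F} {C : ℝ} (hC : ∀ y, ‖T y‖ ≤ C) :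
    IsClosed {v | Continuous fun y => T y v} := by
  refine isClosed_of_closure_subset fun v hv =>
    continuous_of_uniform_approx_of_continuous fun U hU => ?_
  obtain ⟨ε, hε, hU⟩ := Metric.mem_uniformity_dist.1 hU
  obtain ⟨w, hw, hvw⟩ := Metric.mem_closure_iff.1 hv (ε / (|C| + 1)) (by positivity)
  refine ⟨_, hw, fun y => hU ?_⟩
  rw [lt_div_iff₀ (by positivity)] at hvw
  rw [dist_eq_norm, ← map_sub]
  rw [dist_eq_norm] at hvw
  calc ‖T y (v - w)‖ ≤ (|C| + 1) * ‖v - w‖ :=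
        (T y).le_of_opNorm_le ((hC y).trans (by linarith [le_abs_self C])) _
    _ < ε := by rwa [mul_comm]

theorem eventually_forall_norm_apply_lt_of_isCompact {ι : Type*} {l : Filter ι}
    {T : ι → E →L[𝕜] F} {M : ℝ} (hM : ∀ i, ‖T i‖ ≤ M) {k : X → E} (hk : Continuous k)
    (hT : ∀ x, Tendsto (fun i => T i (k x)) l (𝓝 0)) {K : Set X} (hK : IsCompact K) {ε : ℝ}
    (hε : 0 < ε) : ∀ᶠ i in l, ∀ x ∈ K, ‖T i (k x)‖ < ε := by
  refine hK.induction_on (p := fun s => ∀ᶠ i in l, ∀ x ∈ s, ‖T i (k x)‖ < ε) (by simp)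
    (fun s t hst ht => ht.mono fun i hi x hx => hi x (hst hx))
    (fun s t hs ht => ?_) (fun x _ => ?_)
  · filter_upwards [hs, ht] with i hsi hti x hx using hx.elim (hsi x) (hti x)
  have near : ∀ᶠ y in 𝓝 x, (|M| + 1) * ‖k y - k x‖ < ε / 2 :=
    (show ContinuousAt (fun y => (|M| + 1) * ‖k y - k x‖) x by fun_prop).eventually_lt
      continuousAt_const (by simpa using half_pos hε)
  refine ⟨_, mem_nhdsWithin_of_mem_nhds near, ?_⟩
  filter_upwards [(tendsto_zero_iff_norm_tendsto_zero.1 (hT x)).eventually_lt_const (half_pos hε)]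
    with i hi y hy
  calc ‖T i (k y)‖ = ‖T i (k y - k x) + T i (k x)‖ := by rw [map_sub, sub_add_cancel]
    _ ≤ (|M| + 1) * ‖k y - k x‖ + ‖T i (k x)‖ := (norm_add_le _ _).trans <| add_le_add_left
        ((T i).le_of_opNorm_le ((hM i).trans (by linarith [le_abs_self M])) _) _
    _ < ε := by linarith [show _ < _ from hy]

theorem mul_div_two_mul_add_one_lt {c ε : ℝ} (hc : 0 ≤ c) (hε : 0 < ε) :
    c * (ε / (2 * (c + 1))) < ε / 2 := by
  rw [← sub_pos]
  field_simp
  linarith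

theorem tendsto_integral_norm_mul_norm_apply [T2Space X] [LocallyCompactSpace X]
    [MeasurableSpace X] [BorelSpace X] {μ : Measure X} [μ.Regular] {ι : Type*} {l : Filter ι}
    {T : ι → E →L[𝕜] F} {M : ℝ} (hM : ∀ i, ‖T i‖ ≤ M) {f : X → ℂ} (hf : Integrable f μ)
    {k : X → E} (hk : Continuous k) {C : ℝ} (hC : ∀ x, ‖k x‖ ≤ C)
    (hT : ∀ x, Tendsto (fun i => T i (k x)) l (𝓝 0)) :
    Tendsto (fun i => ∫ x, ‖f x‖ * ‖T i (k x)‖ ∂μ) l (𝓝 0) := by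
  have hTk : ∀ i x, ‖T i (k x)‖ ≤ |M| * |C| := fun i x => (T i).le_of_opNorm_le_of_le
    ((hM i).trans (le_abs_self M)) ((hC x).trans (le_abs_self C))
  have hint : ∀ i, Integrable (fun x => ‖f x‖ * ‖T i (k x)‖) μ := fun i =>
    integrable_smul_of_continuous_of_norm_le hf.norm (by fun_prop) fun x => by
      simpa using hTk i x
  refine tendsto_order.2 ⟨fun a ha => .of_forall fun i => ha.trans_le <|
    integral_nonneg fun x => by positivity, fun ε hε => ?_⟩
  obtain ⟨K, hK, hfK⟩ := exists_isCompact_setIntegral_compl_norm_le hf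
    (ε := ε / (2 * (|M| * |C| + 1))) (by positivity)
  set I := ∫ x, ‖f x‖ ∂μ
  have hI : 0 ≤ I := integral_nonneg fun x => norm_nonneg _
  filter_upwards [eventually_forall_norm_apply_lt_of_isCompact hM hk hT hK
    (ε := ε / (2 * (I + 1))) (by positivity)] with i hi
  have on_compact : ∫ x in K, ‖f x‖ * ‖T i (k x)‖ ∂μ ≤ I * (ε / (2 * (I + 1))) := by
    rw [← integral_mul_const]
    refine (setIntegral_mono_on (hint i).integrableOn (hf.norm.mul_const _).integrableOn
      hK.measurableSet fun x hx => ?_).trans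
        (setIntegral_le_integral (hf.norm.mul_const _) (ae_of_all _ fun x => by positivity))
    exact mul_le_mul_of_nonneg_left (hi x hx).le (norm_nonneg _)
  have on_compl : ∫ x in Kᶜ, ‖f x‖ * ‖T i (k x)‖ ∂μ ≤
      |M| * |C| * (ε / (2 * (|M| * |C| + 1))) := by
    refine le_trans ?_ (mul_le_mul_of_nonneg_left hfK (by positivity))
    rw [mul_comm, ← integral_mul_const]
    exact setIntegral_mono (hint i).integrableOn (hf.norm.mul_const _).integrableOn fun x =>
      mul_le_mul_of_nonneg_left (hTk i x) (norm_nonneg _)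
  rw [← integral_add_compl hK.measurableSet (hint i)]
  have half_compact := mul_div_two_mul_add_one_lt hI hε
  have half_compl := mul_div_two_mul_add_one_lt (c := |M| * |C|) (by positivity) hε
  linarith

end OperatorFamily

/-! ### Strongly continuous families of contractions and translations -/

section ContractiveFamily

variable {X : Type*} [TopologicalSpace X] {E F : Type*} [NormedAddCommGroup E] [NormedSpace ℂ E]
  [NormedAddCommGroup F] [NormedSpace ℂ F]

/-- A strongly continuous family of contractions. -/
structure IsContractiveFamily (T : X → E →L[ℂ] F) : Prop where
  norm_apply_le : ∀ y v, ‖T y v‖ ≤ ‖v‖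
  continuous_apply : ∀ v, Continuous fun y => T y v

namespace IsContractiveFamily

variable {T : X → E →L[ℂ] F}

theorem comp {Y : Type*} [TopologicalSpace Y] (hT : IsContractiveFamily T) {φ : Y → X}
    (hφ : Continuous φ) : IsContractiveFamily (T ∘ φ) :=
  ⟨fun y => hT.norm_apply_le (φ y), fun v => (hT.continuous_apply v).comp hφ⟩

variable [MeasurableSpace X] {μ : Measure X}

theorem norm_integral_le (hT : IsContractiveFamily T) (f : Lp ℂ 1 μ) (v : E) :
    ‖∫ y, f y • T y v ∂μ‖ ≤ ‖f‖ * ‖v‖ := by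
  rw [L1.norm_eq_integral_norm f, ← integral_mul_const]
  refine norm_integral_le_of_norm_le ((L1.integrable_coeFn f).norm.mul_const _)
    (ae_of_all _ fun y => ?_)
  rw [norm_smul]
  exact mul_le_mul_of_nonneg_left (hT.norm_apply_le y v) (norm_nonneg _)

variable [T2Space X] [LocallyCompactSpace X] [BorelSpace X] [μ.Regular]

theorem integrable (hT : IsContractiveFamily T) (f : Lp ℂ 1 μ) (v : E) :
    Integrable (fun y => f y • T y v) μ :=
  integrable_smul_of_continuous_of_norm_le (L1.integrable_coeFn f) (hT.continuous_apply v)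
    fun y => hT.norm_apply_le y v

variable (μ) in
/-- The integrated operators `∫ f(y) T_y dy`, as a bounded bilinear map of the density `f` and the
argument. -/
def integrated (hT : IsContractiveFamily T) : Lp ℂ 1 μ →L[ℂ] E →L[ℂ] F :=
  LinearMap.mkContinuous₂
    (LinearMap.mk₂ ℂ (fun f v => ∫ y, f y • T y v ∂μ)
      (fun f g v => by
        rw [← integral_add (hT.integrable f v) (hT.integrable g v)]
        refine integral_congr_ae ?_
        filter_upwards [Lp.coeFn_add f g] with y hy using by rw [hy, Pi.add_apply, add_smul])
      (fun c f v => by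
        rw [← integral_smul]
        refine integral_congr_ae ?_
        filter_upwards [Lp.coeFn_smul c f] with y hy using by rw [hy, Pi.smul_apply, smul_assoc])
      (fun f v w => by
        rw [← integral_add (hT.integrable f v) (hT.integrable f w)]
        simp only [map_add, smul_add])
      (fun c f v => by
        rw [← integral_smul]
        simp only [map_smul, smul_comm c]))
    1 (fun f v => by simpa only [one_mul, LinearMap.mk₂_apply] using hT.norm_integral_le f v)

theorem integrated_apply (hT : IsContractiveFamily T) (f : Lp ℂ 1 μ) (v : E) :
    hT.integrated μ f v = ∫ y, f y • T y v ∂μ := rfl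

theorem norm_integrated_apply_le (hT : IsContractiveFamily T) (f : Lp ℂ 1 μ) (v : E) :
    ‖hT.integrated μ f v‖ ≤ ‖f‖ * ‖v‖ := hT.norm_integral_le f v

variable {H : Type*} [NormedAddCommGroup H] [NormedSpace ℂ H]

theorem map_integrated [CompleteSpace F] [CompleteSpace H] (hT : IsContractiveFamily T)
    (S : F →L[ℂ] H) (f : Lp ℂ 1 μ) (v : E) :
    S (hT.integrated μ f v) = ∫ y, f y • S (T y v) ∂μ := by
  rw [integrated_apply, ← S.integral_comp_comm (hT.integrable f v)]
  simp only [map_smul]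

end IsContractiveFamily

end ContractiveFamily

section RightTranslation

open Measure

variable {G : Type*} [Group G] [TopologicalSpace G] [IsTopologicalGroup G]
  [LocallyCompactSpace G]

theorem modularCharacterFun_mul_inv_self (w : G) :
    (modularCharacterFun w : ℝ) * modularCharacterFun w⁻¹ = 1 := by
  rw [← NNReal.coe_mul, ← modularCharacterFun_map_mul, mul_inv_cancel, modularCharacterFun_map_one,
    NNReal.coe_one]

variable [MeasurableSpace G] [BorelSpace G]

section Haar

variable (μ : Measure G) [μ.IsHaarMeasure] [μ.Regular]

theorem map_mul_right_eq_modularCharacterFun_smul (w : G) :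
    μ.map (· * w) = modularCharacterFun w • μ := by
  have : (μ.map (· * w)).Regular := Regular.map (Homeomorph.mulRight w)
  rw [modularCharacterFun_eq_haarScalarFactor μ]
  exact isMulLeftInvariant_eq_smul_of_regular _ μ

theorem quasiMeasurePreserving_mul_right (w : G) : QuasiMeasurePreserving (· * w) μ μ := by
  refine ⟨(continuous_mul_const w).measurable, ?_⟩
  rw [map_mul_right_eq_modularCharacterFun_smul]
  exact smul_absolutelyContinuous

theorem integral_comp_mul_right_haar {E : Type*} [NormedAddCommGroup E] [NormedSpace ℝ E]
    (f : G → E) (w : G) : ∫ x, f (x * w) ∂μ = (modularCharacterFun w : ℝ) • ∫ x, f x ∂μ := by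
  rw [← (measurableEmbedding_mulRight w).integral_map (μ := μ) f,
    map_mul_right_eq_modularCharacterFun_smul, integral_smul_nnreal_measure]
  rfl

theorem integrable_comp_mul_right {E : Type*} [NormedAddCommGroup E] {f : G → E}
    (hf : Integrable f μ) (w : G) : Integrable (fun x => f (x * w)) μ := by
  refine ((measurableEmbedding_mulRight w).integrable_map_iff (μ := μ) (g := f)).1 ?_
  rw [map_mul_right_eq_modularCharacterFun_smul]
  exact hf.smul_measure_nnreal

end Haar

theorem continuous_integral_comp_mul_right {f : G → ℝ} (hf : Continuous f)
    (hfs : HasCompactSupport f) (μ : Measure G) [IsFiniteMeasureOnCompacts μ] :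
    Continuous fun w => ∫ x, f (x * w) ∂μ := by
  refine continuous_iff_continuousAt.2 fun w₀ => ?_
  obtain ⟨N, hN, hNw⟩ := exists_compact_mem_nhds w₀
  refine ContinuousOn.continuousAt (s := N) ?_ hNw
  refine continuousOn_integral_of_compact_support (k := (fun p : G × G => p.1 * p.2⁻¹) ''
    (tsupport f ×ˢ N)) ((hfs.isCompact.prod hN).image (by fun_prop)) (by fun_prop)
    fun w x hw hx => ?_
  contrapose! hx
  exact ⟨(x * w, w), ⟨subset_tsupport _ hx, hw⟩, mul_inv_cancel_right x w⟩

theorem continuous_modularCharacterFun : Continuous fun w : G => (modularCharacterFun w : ℝ) := by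
  borelize G
  obtain ⟨⟨f, hf⟩, hfs, hf0, hf1⟩ : ∃ f : C(G, ℝ), HasCompactSupport f ∧ 0 ≤ f ∧ f 1 ≠ 0 :=
    exists_continuous_nonneg_pos 1
  have hpos : ∫ x, f x ∂(haar : Measure G) ≠ 0 :=
    (hf.integral_pos_of_hasCompactSupport_nonneg_nonzero hfs hf0 hf1).ne'
  have quotient : (fun w : G => (modularCharacterFun w : ℝ)) =
      fun w => (∫ x, f (x * w) ∂(haar : Measure G)) / ∫ x, f x ∂(haar : Measure G) := by
    funext w
    rw [integral_comp_mul_right_haar, smul_eq_mul, mul_div_cancel_right₀ _ hpos]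
  rw [quotient]
  exact (continuous_integral_comp_mul_right hf hfs haar).div_const _

theorem continuous_integral_norm_sub_rightTranslate {g : G → ℂ} (hg : Continuous g)
    (hgs : HasCompactSupport g) (μ : Measure G) [IsFiniteMeasureOnCompacts μ] (w₀ : G) :
    Continuous fun w => ∫ x, ‖((modularCharacterFun w : ℝ) : ℂ) * g (x * w⁻¹) -
      ((modularCharacterFun w₀ : ℝ) : ℂ) * g (x * w₀⁻¹)‖ ∂μ := by
  have hΔ : Continuous fun p : G × G => ((modularCharacterFun p.1 : ℝ) : ℂ) :=
    Complex.continuous_ofReal.comp (continuous_modularCharacterFun.comp continuous_fst)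
  refine continuous_iff_continuousAt.2 fun w₁ => ?_
  obtain ⟨N, hN, hNw₁⟩ := exists_compact_mem_nhds w₁
  refine ContinuousOn.continuousAt (s := N) ?_ hNw₁
  refine continuousOn_integral_of_compact_support
    (k := (fun p : G × G => p.1 * p.2) '' (tsupport g ×ˢ insert w₀ N))
    ((hgs.isCompact.prod (hN.insert w₀)).image continuous_mul)
    ((hΔ.mul (by fun_prop)).sub (by fun_prop)).norm.continuousOn fun w x hw hx => ?_
  have vanish : ∀ v ∈ insert w₀ N, g (x * v⁻¹) = 0 := fun v hv => by
    contrapose! hx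
    exact ⟨(x * v⁻¹, v), ⟨subset_tsupport _ hx, hv⟩, inv_mul_cancel_right x v⟩
  simp [vanish w (.inr hw), vanish w₀ (.inl rfl)]

variable {μ : Measure G} [μ.IsHaarMeasure] [μ.Regular]

/-- Right translation on `L¹(G)`, the operator `a ↦ a * δ_w` given by
`(a * δ_w)(x) = Δ(w) a(x w⁻¹)`, where Mathlib's modular function `Δ` is normalised by
`∫ f(x w) dx = Δ(w) ∫ f(x) dx`. -/
def rightTranslate (w : G) (a : Lp ℂ 1 μ) : Lp ℂ 1 μ :=
  ((integrable_comp_mul_right μ (L1.integrable_coeFn a) w⁻¹).const_mul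
    ((modularCharacterFun w : ℝ) : ℂ)).toL1 _

theorem coeFn_rightTranslate (w : G) (a : Lp ℂ 1 μ) :
    rightTranslate w a =ᵐ[μ] fun x => ((modularCharacterFun w : ℝ) : ℂ) * a (x * w⁻¹) :=
  Integrable.coeFn_toL1 _

theorem norm_rightTranslate (w : G) (a : Lp ℂ 1 μ) : ‖rightTranslate w a‖ = ‖a‖ := by
  have pointwise : ∀ᵐ x ∂μ, ‖rightTranslate w a x‖ = modularCharacterFun w * ‖a (x * w⁻¹)‖ := by
    filter_upwards [coeFn_rightTranslate w a] with x hx using by simp [hx]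
  rw [L1.norm_eq_integral_norm, L1.norm_eq_integral_norm, integral_congr_ae pointwise,
    integral_const_mul, integral_comp_mul_right_haar μ (fun x => ‖a x‖), smul_eq_mul, ← mul_assoc,
    modularCharacterFun_mul_inv_self, one_mul]

variable (μ) in
/-- Right translation as a continuous linear map. -/
def rightTranslateL (w : G) : Lp ℂ 1 μ →L[ℂ] Lp ℂ 1 μ :=
  LinearIsometry.toContinuousLinearMap
    { toFun := rightTranslate w
      map_add' := fun a b => by
        refine Lp.ext ?_
        filter_upwards [coeFn_rightTranslate w (a + b), coeFn_rightTranslate w a,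
          coeFn_rightTranslate w b, Lp.coeFn_add (rightTranslate w a) (rightTranslate w b),
          (quasiMeasurePreserving_mul_right μ w⁻¹).ae (Lp.coeFn_add a b)]
          with x hab ha hb hadd hx
        rw [hab, hadd, Pi.add_apply, ha, hb, hx, Pi.add_apply, mul_add]
      map_smul' := fun c a => by
        refine Lp.ext ?_
        filter_upwards [coeFn_rightTranslate w (c • a), coeFn_rightTranslate w a,
          Lp.coeFn_smul c (rightTranslate w a),
          (quasiMeasurePreserving_mul_right μ w⁻¹).ae (Lp.coeFn_smul c a)] with x hca ha hsmul hx
        rw [hca, RingHom.id_apply, hsmul, Pi.smul_apply, ha, hx, Pi.smul_apply, mul_smul_comm]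
      norm_map' := norm_rightTranslate w }

theorem rightTranslateL_apply (w : G) (a : Lp ℂ 1 μ) :
    rightTranslateL μ w a = rightTranslate w a := rfl

theorem rightTranslate_mul (y z : G) (a : Lp ℂ 1 μ) :
    rightTranslate (y * z) a = rightTranslate z (rightTranslate y a) := by
  refine Lp.ext ?_
  filter_upwards [coeFn_rightTranslate (y * z) a, coeFn_rightTranslate z (rightTranslate y a),
    (quasiMeasurePreserving_mul_right μ z⁻¹).ae (coeFn_rightTranslate y a)] with x hyz hz hy
  rw [hyz, hz, hy, modularCharacterFun_map_mul, mul_inv_rev, mul_assoc x]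
  push_cast
  ring

theorem rightTranslate_leftTranslate (w y : G) (a : Lp ℂ 1 μ) :
    rightTranslate w (leftTranslate y a) = leftTranslate y (rightTranslate w a) := by
  refine Lp.ext ?_
  filter_upwards [coeFn_rightTranslate w (leftTranslate y a),
    (quasiMeasurePreserving_mul_right μ w⁻¹).ae (coeFn_leftTranslate y a),
    coeFn_leftTranslate y (rightTranslate w a),
    (measurePreserving_mul_left μ y⁻¹).quasiMeasurePreserving.ae (coeFn_rightTranslate w a)]
    with x hwy hy hyw hw
  rw [hwy, hy, hyw, hw, mul_assoc]

theorem rightTranslate_conv (w : G) (a g : Lp ℂ 1 μ) :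
    l1Conv (rightTranslate w a) g = l1Conv a (leftTranslate w g) := by
  have hΔ : (modularCharacterFun w : ℝ) ≠ 0 := (NNReal.coe_pos.2 (modularCharacterFun_pos w)).ne'
  refine smul_right_injective _ hΔ ?_
  simp only [l1Conv]
  rw [← integral_comp_mul_right_haar, ← integral_smul]
  refine integral_congr_ae ?_
  filter_upwards [(quasiMeasurePreserving_mul_right μ w).ae (coeFn_rightTranslate w a)] with y hy
  rw [hy, mul_inv_cancel_right, leftTranslate_mul, mul_smul]
  exact algebraMap_smul ℂ (modularCharacterFun w : ℝ) (a y • leftTranslate y (leftTranslate w g))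

variable [T2Space G]

theorem continuous_rightTranslate (a : Lp ℂ 1 μ) : Continuous fun w : G => rightTranslate w a := by
  refine l1_induction_of_hasCompactSupport (p := fun a => Continuous fun w => rightTranslateL μ w a)
    (isClosed_setOf_continuous_apply (C := 1) fun w =>
      LinearIsometry.norm_toContinuousLinearMap_le _)
    (fun g hg hgs => continuous_iff_continuousAt.2 fun w₀ => ?_) a
  set b := (hg.integrable_of_hasCompactSupport (μ := μ) hgs).toL1 g
  have coe_translate : ∀ w, rightTranslate w b =ᵐ[μ]
      fun x => ((modularCharacterFun w : ℝ) : ℂ) * g (x * w⁻¹) := fun w => by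
    filter_upwards [coeFn_rightTranslate w b, (quasiMeasurePreserving_mul_right μ w⁻¹).ae
      (hg.integrable_of_hasCompactSupport (μ := μ) hgs).coeFn_toL1] with x hw hx
    rw [hw, hx]
  have norm_sub : ∀ w, ‖rightTranslate w b - rightTranslate w₀ b‖ =
      ∫ x, ‖((modularCharacterFun w : ℝ) : ℂ) * g (x * w⁻¹) -
        ((modularCharacterFun w₀ : ℝ) : ℂ) * g (x * w₀⁻¹)‖ ∂μ := fun w => by
    rw [L1.norm_eq_integral_norm]
    refine integral_congr_ae ?_
    filter_upwards [Lp.coeFn_sub (rightTranslate w b) (rightTranslate w₀ b), coe_translate w,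
      coe_translate w₀] with x hsub hw hw₀
    rw [hsub, Pi.sub_apply, hw, hw₀]
  refine tendsto_iff_norm_sub_tendsto_zero.2 ?_
  simp only [rightTranslateL_apply, norm_sub]
  simpa using (continuous_integral_norm_sub_rightTranslate hg hgs μ w₀).tendsto w₀

theorem isContractiveFamily_leftTranslateL : IsContractiveFamily (leftTranslateL μ) :=
  ⟨fun y a => (norm_leftTranslate y a).le, continuous_leftTranslate⟩

theorem isContractiveFamily_rightTranslateL : IsContractiveFamily (rightTranslateL μ) :=
  ⟨fun y a => (norm_rightTranslate y a).le, continuous_rightTranslate⟩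

end RightTranslation

/-! ### Probability densities and convolution -/

theorem exists_net_tendsto_zero {X ι E : Type*} [SeminormedAddCommGroup E] {P : X → Prop}
    {F : ι → X → E}
    (h : ∀ (S : Finset ι) (ε : ℝ), 0 < ε → ∃ x, P x ∧ ∀ i ∈ S, ‖F i x‖ < ε) :
    ∃ t : Finset ι × ℕ → X, (∀ n, P (t n)) ∧ ∀ i, Tendsto (fun n => F i (t n)) atTop (𝓝 0) := by
  classical
  choose t htP ht using fun n : Finset ι × ℕ => h n.1 (1 / ((n.2 : ℝ) + 1)) (by positivity)
  refine ⟨t, htP, fun i => Metric.tendsto_nhds.2 fun ε hε => ?_⟩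
  obtain ⟨N, hN⟩ := exists_nat_one_div_lt hε
  filter_upwards [eventually_ge_atTop (({i}, N) : Finset ι × ℕ)] with n hn
  have hNn : (N : ℝ) ≤ n.2 := by exact_mod_cast hn.2
  rw [dist_zero_right]
  calc ‖F i (t n)‖ < 1 / ((n.2 : ℝ) + 1) := ht n i (hn.1 (Finset.mem_singleton_self i))
    _ ≤ 1 / ((N : ℝ) + 1) := by gcongr
    _ < ε := hN

section ProbabilityDensities

variable {X : Type*} [MeasurableSpace X] (μ : Measure X)

/-- The integral as a bounded functional on `L¹`; on the group algebra it is a character. -/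
def augmentation : Lp ℂ 1 μ →L[ℂ] ℂ := L1.integralCLM' ℂ

/-- The probability densities in `L¹`. Norm at most one and integral one together force such a
function to be nonnegative almost everywhere. -/
def probabilityDensities : Set (Lp ℂ 1 μ) := {g | ‖g‖ ≤ 1 ∧ augmentation μ g = 1}

variable {μ}

theorem augmentation_apply (a : Lp ℂ 1 μ) : augmentation μ a = ∫ x, a x ∂μ :=
  (L1.integral_eq' ℂ a).symm.trans (L1.integral_eq_integral a)

theorem IsContractiveFamily.norm_map_integrated_sub_le [TopologicalSpace X] [T2Space X]
    [LocallyCompactSpace X] [BorelSpace X] [μ.Regular] {E F H : Type*} [NormedAddCommGroup E]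
    [NormedSpace ℂ E] [NormedAddCommGroup F] [NormedSpace ℂ F] [CompleteSpace F]
    [NormedAddCommGroup H] [NormedSpace ℂ H] [CompleteSpace H] {T : X → E →L[ℂ] F}
    (hT : IsContractiveFamily T) {f : Lp ℂ 1 μ} (hf : augmentation μ f = 1) (S : F →L[ℂ] H)
    (v : E) (w : H) :
    ‖S (hT.integrated μ f v) - w‖ ≤ ∫ y, ‖f y‖ * ‖S (T y v) - w‖ ∂μ := by
  have integrable_map : Integrable (fun y => f y • S (T y v)) μ := by
    simpa only [map_smul] using S.integrable_comp (hT.integrable f v)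
  calc ‖S (hT.integrated μ f v) - w‖ = ‖∫ y, f y • (S (T y v) - w) ∂μ‖ := by
        simp only [smul_sub]
        rw [integral_sub integrable_map ((L1.integrable_coeFn f).smul_const w),
          integral_smul_const, ← augmentation_apply, hf, one_smul, hT.map_integrated]
    _ ≤ ∫ y, ‖f y‖ * ‖S (T y v) - w‖ ∂μ := by
        simpa only [norm_smul] using norm_integral_le_integral_norm fun y => f y • (S (T y v) - w)

theorem convex_probabilityDensities : Convex ℝ (probabilityDensities μ) := by
  intro g hg h hh s t hs ht hst
  refine ⟨mem_closedBall_zero_iff.1 <| convex_closedBall (0 : Lp ℂ 1 μ) 1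
    (mem_closedBall_zero_iff.2 hg.1) (mem_closedBall_zero_iff.2 hh.1) hs ht hst, ?_⟩
  rw [map_add, ← algebraMap_smul ℂ s g, ← algebraMap_smul ℂ t h, map_smul, map_smul, hg.2, hh.2]
  simpa using congrArg (fun r : ℝ => (r : ℂ)) hst

theorem indicatorConstLp_mem_probabilityDensities {K : Set X} (hK : MeasurableSet K)
    (hμK : μ K ≠ ∞) (hμK₀ : μ K ≠ 0) :
    indicatorConstLp 1 hK hμK (((μ.real K)⁻¹ : ℝ) : ℂ) ∈ probabilityDensities μ := by
  have hpos : 0 < μ.real K := ENNReal.toReal_pos hμK₀ hμK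
  constructor
  · rw [norm_indicatorConstLp one_ne_zero ENNReal.one_ne_top, Complex.norm_real,
      Real.norm_of_nonneg (inv_pos.2 hpos).le, ENNReal.toReal_one, div_one, Real.rpow_one,
      inv_mul_cancel₀ hpos.ne']
  · rw [augmentation_apply, integral_indicatorConstLp, Complex.real_smul, ← Complex.ofReal_mul,
      mul_inv_cancel₀ hpos.ne', Complex.ofReal_one]

end ProbabilityDensities

section Pairing

open scoped BoundedContinuousFunction

variable {X : Type*} [TopologicalSpace X] [MeasurableSpace X] [BorelSpace X] {μ : Measure X}

theorem integrable_boundedContinuousFunction_smul {F : Type*} [NormedAddCommGroup F]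
    [NormedSpace ℝ F] (k : X →ᵇ ℝ) {f : X → F} (hf : Integrable f μ) :
    Integrable (fun x => k x • f x) μ :=
  hf.bdd_smul ‖k‖ k.continuous.aestronglyMeasurable (ae_of_all _ k.norm_coe_le_norm)

variable (μ) in
/-- The functional `a ↦ ∫ k a` on `L¹` given by a bounded continuous function `k`. -/
def pairing (k : X →ᵇ ℝ) : Lp ℂ 1 μ →L[ℂ] ℂ :=
  LinearMap.mkContinuous
    { toFun := fun a => ∫ x, k x • a x ∂μ
      map_add' := fun a b => by
        rw [← integral_add (integrable_boundedContinuousFunction_smul k (L1.integrable_coeFn a))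
          (integrable_boundedContinuousFunction_smul k (L1.integrable_coeFn b))]
        refine integral_congr_ae ?_
        filter_upwards [Lp.coeFn_add a b] with x hx using by rw [hx, Pi.add_apply, smul_add]
      map_smul' := fun c a => by
        rw [RingHom.id_apply, ← integral_smul]
        refine integral_congr_ae ?_
        filter_upwards [Lp.coeFn_smul c a] with x hx using by rw [hx, Pi.smul_apply, smul_comm] }
    ‖k‖ (fun a => by
      rw [L1.norm_eq_integral_norm a, ← integral_const_mul]
      refine norm_integral_le_of_norm_le ((L1.integrable_coeFn a).norm.const_mul _)
        (ae_of_all _ fun x => ?_)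
      rw [norm_smul]
      exact mul_le_mul_of_nonneg_right (k.norm_coe_le_norm x) (norm_nonneg _))

theorem pairing_apply (k : X →ᵇ ℝ) (a : Lp ℂ 1 μ) : pairing μ k a = ∫ x, k x • a x ∂μ := rfl

theorem eq_of_forall_pairing_eq [T2Space X] [LocallyCompactSpace X] [μ.Regular] {a b : Lp ℂ 1 μ}
    (h : ∀ k : X →ᵇ ℝ, pairing μ k a = pairing μ k b) : a = b := by
  refine sub_eq_zero.1 (Lp.eq_zero_iff_ae_eq_zero.2 ?_)
  refine ae_eq_zero_of_forall_integral_continuous_smul_eq_zero (L1.integrable_coeFn _)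
    fun φ hφ hφs => ?_
  obtain ⟨C, hC⟩ := hφ.bounded_above_of_compact_support hφs
  exact ((pairing μ (.ofNormedAddCommGroup φ hφ C hC)).map_sub a b).trans (sub_eq_zero.2 (h _))

end Pairing

section Convolution

open scoped BoundedContinuousFunction

variable {G : Type*} [Group G] [TopologicalSpace G] [IsTopologicalGroup G]
  [MeasurableSpace G] [BorelSpace G]

section LeftInvariant

variable {μ : Measure G} [μ.IsMulLeftInvariant]

theorem leftTranslate_one (a : Lp ℂ 1 μ) : leftTranslate 1 a = a := by
  refine Lp.ext ?_
  filter_upwards [coeFn_leftTranslate 1 a] with x hx using by rw [hx, inv_one, one_mul]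

theorem augmentation_leftTranslate (y : G) (a : Lp ℂ 1 μ) :
    augmentation μ (leftTranslate y a) = augmentation μ a := by
  rw [augmentation_apply, augmentation_apply, integral_congr_ae (coeFn_leftTranslate y a),
    integral_mul_left_eq_self (fun x => a x)]

theorem leftTranslate_mem_probabilityDensities (y : G) {g : Lp ℂ 1 μ}
    (hg : g ∈ probabilityDensities μ) : leftTranslate y g ∈ probabilityDensities μ :=
  ⟨(norm_leftTranslate y g).trans_le hg.1, (augmentation_leftTranslate y g).trans hg.2⟩

theorem pairing_leftTranslate (k : G →ᵇ ℝ) (y : G) (a : Lp ℂ 1 μ) :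
    pairing μ k (leftTranslate y a) = ∫ x, k (y * x) • a x ∂μ := by
  rw [pairing_apply, ← integral_mul_left_eq_self _ y]
  refine integral_congr_ae ?_
  filter_upwards [(measurePreserving_mul_left μ y).quasiMeasurePreserving.ae
    (coeFn_leftTranslate y a)] with x hx
  rw [hx, inv_mul_cancel_left]

end LeftInvariant

variable [LocallyCompactSpace G] {μ : Measure G} [μ.IsHaarMeasure] [μ.Regular]

theorem pairing_rightTranslate (k : G →ᵇ ℝ) (w : G) (a : Lp ℂ 1 μ) :
    pairing μ k (rightTranslate w a) = ∫ x, k (x * w) • a x ∂μ := by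
  have hΔ : (Measure.modularCharacterFun w : ℝ) ≠ 0 :=
    (NNReal.coe_pos.2 (Measure.modularCharacterFun_pos w)).ne'
  refine smul_right_injective _ hΔ ?_
  simp only [pairing_apply]
  rw [← integral_comp_mul_right_haar, ← integral_smul]
  refine integral_congr_ae ?_
  filter_upwards [(quasiMeasurePreserving_mul_right μ w).ae (coeFn_rightTranslate w a)] with y hy
  rw [hy, mul_inv_cancel_right, ← Complex.real_smul, smul_comm]

variable [T2Space G]

theorem conv_eq_integrated_left (a b : Lp ℂ 1 μ) :
    l1Conv a b = isContractiveFamily_leftTranslateL.integrated μ a b := rfl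

theorem pairing_conv (k : G →ᵇ ℝ) (a b : Lp ℂ 1 μ) :
    pairing μ k (l1Conv a b) = ∫ y, ∫ x, k (y * x) • (a y * b x) ∂μ ∂μ := by
  rw [conv_eq_integrated_left, IsContractiveFamily.map_integrated]
  simp only [leftTranslateL_apply, pairing_leftTranslate, smul_eq_mul, ← integral_const_mul,
    mul_smul_comm]

theorem pairing_integrated_right (k : G →ᵇ ℝ) (a b : Lp ℂ 1 μ) :
    pairing μ k (isContractiveFamily_rightTranslateL.integrated μ b a) =
      ∫ w, ∫ x, k (x * w) • (b w * a x) ∂μ ∂μ := by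
  rw [IsContractiveFamily.map_integrated]
  simp only [rightTranslateL_apply, pairing_rightTranslate, smul_eq_mul,
    ← integral_const_mul, mul_smul_comm]

theorem conv_toL1_eq_integrated_right {f g : G → ℂ} (hf : Continuous f) (hfs : HasCompactSupport f)
    (hg : Continuous g) (hgs : HasCompactSupport g) (hfi : Integrable f μ) (hgi : Integrable g μ) :
    l1Conv (hfi.toL1 f) (hgi.toL1 g) =
      isContractiveFamily_rightTranslateL.integrated μ (hgi.toL1 g) (hfi.toL1 f) := by
  refine eq_of_forall_pairing_eq fun k => ?_
  rw [pairing_conv, pairing_integrated_right]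
  calc ∫ y, ∫ x, k (y * x) • (hfi.toL1 f y * hgi.toL1 g x) ∂μ ∂μ
      = ∫ y, ∫ x, k (y * x) • (f y * g x) ∂μ ∂μ := by
        refine integral_congr_ae ?_
        filter_upwards [hfi.coeFn_toL1] with y hy
        refine integral_congr_ae ?_
        filter_upwards [hgi.coeFn_toL1] with x hx using by rw [hx, hy]
    _ = ∫ w, ∫ x, k (x * w) • (f x * g w) ∂μ ∂μ := by
        refine integral_integral_swap_of_hasCompactSupport (by fun_prop) ?_
        refine HasCompactSupport.intro (hfs.isCompact.prod hgs.isCompact) fun p hp => ?_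
        rcases not_and_or.1 hp with hp | hp <;>
          simp [Function.uncurry, image_eq_zero_of_notMem_tsupport hp]
    _ = ∫ w, ∫ x, k (x * w) • (hgi.toL1 g w * hfi.toL1 f x) ∂μ ∂μ := by
        refine integral_congr_ae ?_
        filter_upwards [hgi.coeFn_toL1] with w hw
        refine integral_congr_ae ?_
        filter_upwards [hfi.coeFn_toL1] with x hx using by rw [hx, hw, mul_comm]

theorem conv_eq_integrated_right (a b : Lp ℂ 1 μ) :
    l1Conv a b = isContractiveFamily_rightTranslateL.integrated μ b a := by
  have closed_left (b : Lp ℂ 1 μ) :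
      IsClosed {a | l1Conv a b = isContractiveFamily_rightTranslateL.integrated μ b a} :=
    isClosed_eq (convRightL b).continuous
      (isContractiveFamily_rightTranslateL.integrated μ b).continuous
  have closed_right (a : Lp ℂ 1 μ) :
      IsClosed {b | l1Conv a b = isContractiveFamily_rightTranslateL.integrated μ b a} :=
    isClosed_eq (isContractiveFamily_leftTranslateL.integrated μ a).continuous
      ((isContractiveFamily_rightTranslateL.integrated μ).continuous.clm_apply continuous_const)
  exact l1_induction_of_hasCompactSupport (closed_left b) (fun f hf hfs =>
    l1_induction_of_hasCompactSupport (closed_right _) (fun g hg hgs =>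
      conv_toL1_eq_integrated_right hf hfs hg hgs _ _) b) a

theorem augmentation_conv (a b : Lp ℂ 1 μ) :
    augmentation μ (l1Conv a b) = augmentation μ a * augmentation μ b := by
  rw [conv_eq_integrated_left, IsContractiveFamily.map_integrated]
  simp only [leftTranslateL_apply, augmentation_leftTranslate, smul_eq_mul]
  rw [integral_mul_const, augmentation_apply a]

theorem conv_mem_probabilityDensities {g h : Lp ℂ 1 μ} (hg : g ∈ probabilityDensities μ)
    (hh : h ∈ probabilityDensities μ) : l1Conv g h ∈ probabilityDensities μ :=
  ⟨(norm_conv_le g h).trans (mul_le_one₀ hg.1 (norm_nonneg _) hh.1), by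
    rw [augmentation_conv, hg.2, hh.2, one_mul]⟩

theorem norm_conv_sub_le {u : Lp ℂ 1 μ} (hu : u ∈ probabilityDensities μ) (a : Lp ℂ 1 μ) {δ : ℝ}
    (hδ : ∀ᵐ y ∂μ, u y = 0 ∨ ‖leftTranslate y a - a‖ ≤ δ) (hδ₀ : 0 ≤ δ) :
    ‖l1Conv u a - a‖ ≤ δ := by
  calc ‖l1Conv u a - a‖ ≤ ∫ y, ‖u y‖ * ‖leftTranslate y a - a‖ ∂μ :=
        isContractiveFamily_leftTranslateL.norm_map_integrated_sub_le hu.2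
          (ContinuousLinearMap.id ℂ _) a a
    _ ≤ ∫ y, ‖u y‖ * δ ∂μ := by
        refine integral_mono_of_nonneg (ae_of_all _ fun y => by positivity)
          ((L1.integrable_coeFn u).norm.mul_const _) ?_
        filter_upwards [hδ] with y hy
        rcases hy with hy | hy
        · simp [hy]
        · exact mul_le_mul_of_nonneg_left hy (norm_nonneg _)
    _ = ‖u‖ * δ := by rw [integral_mul_const, L1.norm_eq_integral_norm]
    _ ≤ δ := mul_le_of_le_one_left hδ₀ hu.1

variable (μ) in
theorem exists_left_approximate_unit : ∃ u : Finset (Lp ℂ 1 μ) × ℕ → Lp ℂ 1 μ,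
    (∀ n, u n ∈ probabilityDensities μ) ∧
      ∀ a, Tendsto (fun n => l1Conv (u n) a - a) atTop (𝓝 0) := by
  refine exists_net_tendsto_zero (F := fun a u => l1Conv u a - a) fun S ε hε => ?_
  have near_one : ∀ᶠ y in 𝓝 (1 : G), ∀ a ∈ S, ‖leftTranslate y a - a‖ < ε / 2 := by
    refine (Finset.eventually_all S).2 fun a _ => ?_
    refine ((continuous_leftTranslate a).sub continuous_const).norm.continuousAt.eventually_lt
      continuousAt_const ?_
    simpa only [Pi.sub_apply, leftTranslate_one, sub_self, norm_zero] using half_pos hε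
  obtain ⟨K, hK1, hKS, hK⟩ := local_compact_nhds near_one
  have density := indicatorConstLp_mem_probabilityDensities hK.measurableSet
    hK.measure_lt_top.ne (Measure.measure_pos_of_mem_nhds μ hK1).ne'
  refine ⟨_, density, fun a ha =>
    (norm_conv_sub_le density a ?_ (half_pos hε).le).trans_lt (half_lt_self hε)⟩
  have coe_density := indicatorConstLp_coeFn (p := 1) (μ := μ) (hs := hK.measurableSet)
    (hμs := hK.measure_lt_top.ne) (c := (((μ.real K)⁻¹ : ℝ) : ℂ))
  filter_upwards [coe_density] with y hy
  by_cases hyK : y ∈ K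
  · exact .inr (hKS hyK a ha).le
  · exact .inl (hy.trans (Set.indicator_of_notMem hyK _))

end Convolution

/-! ### Invariant means and Reiter's condition -/

namespace LInftyFun

variable {X : Type*} [TopologicalSpace X] [MeasurableSpace X] {μ : Measure X}
  {m : LInftyFun μ →ₗ[ℝ] ℝ}

theorem mul_apply_one_le
    (hm : ∀ f : LInftyFun μ, (∀ K, IsCompact K → ∀ᵐ x ∂μ.restrict K, 0 ≤ f.1 x) → 0 ≤ m f)
    {f : LInftyFun μ} {c : ℝ} (hf : ∀ K, IsCompact K → ∀ᵐ x ∂μ.restrict K, c ≤ f.1 x) :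
    c * m (one μ) ≤ m f := by
  have h := hm (f - c • one μ) fun K hK => (hf K hK).mono fun x hx =>
    sub_nonneg.2 ((mul_one c).trans_le hx)
  rwa [map_sub, map_smul, smul_eq_mul, sub_nonneg] at h

theorem abs_apply_le
    (hm : ∀ f : LInftyFun μ, (∀ K, IsCompact K → ∀ᵐ x ∂μ.restrict K, 0 ≤ f.1 x) → 0 ≤ m f)
    {f : LInftyFun μ} {C : ℝ} (hf : ∀ K, IsCompact K → ∀ᵐ x ∂μ.restrict K, |f.1 x| ≤ C) :
    |m f| ≤ C * m (one μ) := by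
  have lower := mul_apply_one_le hm fun K hK => (hf K hK).mono fun x hx => neg_le_of_abs_le hx
  have upper := mul_apply_one_le hm (f := -f) fun K hK =>
    (hf K hK).mono fun x hx => neg_le_neg (le_of_abs_le hx)
  rw [neg_mul] at lower upper
  rw [map_neg, neg_le_neg_iff] at upper
  exact abs_le.2 ⟨lower, upper⟩

end LInftyFun

section InvariantMean

variable {G : Type*} [Group G] [TopologicalSpace G] [IsTopologicalGroup G]
  [MeasurableSpace G] [BorelSpace G]

/-- A left invariant mean: the property of `m` in the definition of an amenable group. -/
structure IsLeftInvariantMean {μ : Measure G} [μ.IsMulLeftInvariant] (m : LInftyFun μ →ₗ[ℝ] ℝ) :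
    Prop where
  one : m (LInftyFun.one μ) = 1
  nonneg : ∀ f : LInftyFun μ,
    (∀ K : Set G, IsCompact K → ∀ᵐ x ∂(μ.restrict K), 0 ≤ f.1 x) → 0 ≤ m f
  translate : ∀ (x : G) (f : LInftyFun μ), m (LInftyFun.translate x f) = m f

namespace IsLeftInvariantMean

section Bounds

variable {μ : Measure G} [μ.IsMulLeftInvariant] {m : LInftyFun μ →ₗ[ℝ] ℝ}

theorem le_apply (hm : IsLeftInvariantMean m) {f : LInftyFun μ} {c : ℝ} (hf : ∀ x, c ≤ f.1 x) :
    c ≤ m f := by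
  simpa only [hm.one, mul_one] using
    LInftyFun.mul_apply_one_le hm.nonneg fun _ _ => ae_of_all _ hf

theorem norm_apply_le (hm : IsLeftInvariantMean m) {f : LInftyFun μ} {C : ℝ}
    (hf : ∀ x, |f.1 x| ≤ C) : ‖m f‖ ≤ C := by
  simpa only [hm.one, mul_one, Real.norm_eq_abs] using
    LInftyFun.abs_apply_le hm.nonneg fun _ _ => ae_of_all _ hf

end Bounds

variable [LocallyCompactSpace G] [T2Space G] {μ : Measure G} [μ.IsHaarMeasure] [μ.Regular]

theorem norm_coefficient_le (ψ : Lp ℂ 1 μ →L[ℝ] ℝ) (e a : Lp ℂ 1 μ) (x : G) :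
    ‖ψ (l1Conv a (leftTranslate x e))‖ ≤ ‖ψ‖ * ‖e‖ * ‖a‖ := by
  refine (ψ.le_opNorm _).trans ?_
  rw [mul_assoc, mul_comm ‖e‖, ← norm_leftTranslate x e]
  exact mul_le_mul_of_nonneg_left (norm_conv_le _ _) (norm_nonneg _)

/-- The coefficient function `x ↦ ψ (a * L_x e)` as an element of `LInftyFun μ`. -/
def coefficient (ψ : Lp ℂ 1 μ →L[ℝ] ℝ) (e a : Lp ℂ 1 μ) : LInftyFun μ :=
  ⟨fun x => ψ (l1Conv a (leftTranslate x e)),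
    fun _ _ => (ψ.continuous.comp ((isContractiveFamily_leftTranslateL.integrated μ
      a).continuous.comp (continuous_leftTranslate e))).aemeasurable,
    ‖ψ‖ * ‖e‖ * ‖a‖, fun _ _ => ae_of_all _ (norm_coefficient_le ψ e a)⟩

variable {m : LInftyFun μ →ₗ[ℝ] ℝ}

/-- The mean of the coefficient function `x ↦ ψ (a * L_x e)`, as a bounded functional of `a`. -/
def meanCoefficient (hm : IsLeftInvariantMean m) (ψ : Lp ℂ 1 μ →L[ℝ] ℝ) (e : Lp ℂ 1 μ) :
    Lp ℂ 1 μ →L[ℝ] ℝ :=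
  AddMonoidHom.toRealLinearMap
    (AddMonoidHom.mk' (fun a => m (coefficient ψ e a)) fun a b => by
      rw [← map_add]
      refine congrArg m (Subtype.ext (funext fun x => ?_))
      exact (congrArg ψ (add_conv _ _ _)).trans (map_add _ _ _))
    (AddMonoidHomClass.continuous_of_bound _ (‖ψ‖ * ‖e‖) fun a =>
      hm.norm_apply_le (norm_coefficient_le ψ e a))

theorem meanCoefficient_apply (hm : IsLeftInvariantMean m) (ψ : Lp ℂ 1 μ →L[ℝ] ℝ)
    (e a : Lp ℂ 1 μ) : hm.meanCoefficient ψ e a = m (coefficient ψ e a) := rfl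

theorem meanCoefficient_rightTranslate (hm : IsLeftInvariantMean m) (ψ : Lp ℂ 1 μ →L[ℝ] ℝ)
    (e : Lp ℂ 1 μ) (w : G) (a : Lp ℂ 1 μ) :
    hm.meanCoefficient ψ e (rightTranslate w a) = hm.meanCoefficient ψ e a := by
  rw [meanCoefficient_apply, meanCoefficient_apply, ← hm.translate w⁻¹ (coefficient ψ e a)]
  refine congrArg m (Subtype.ext (funext fun x => ?_))
  change ψ (l1Conv (rightTranslate w a) (leftTranslate x e)) =
    ψ (l1Conv a (leftTranslate (w⁻¹⁻¹ * x) e))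
  rw [rightTranslate_conv, inv_inv, leftTranslate_mul]

theorem meanCoefficient_conv_eq_zero (hm : IsLeftInvariantMean m) (ψ : Lp ℂ 1 μ →L[ℝ] ℝ)
    (e a : Lp ℂ 1 μ) {b : Lp ℂ 1 μ} (hb : augmentation μ b = 0) :
    hm.meanCoefficient ψ e (l1Conv a b) = 0 := by
  set M := hm.meanCoefficient ψ e
  calc M (l1Conv a b) = ∫ y, M (b y • rightTranslate y a) ∂μ := by
        rw [conv_eq_integrated_right]
        exact (M.integral_comp_comm (isContractiveFamily_rightTranslateL.integrable b a)).symm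
    _ = ∫ y, M (b y • a) ∂μ := by
        refine integral_congr_ae (ae_of_all _ fun y => ?_)
        change M (b y • rightTranslateL μ y a) = M (b y • a)
        rw [← map_smul]
        exact hm.meanCoefficient_rightTranslate ψ e y (b y • a)
    _ = 0 := by
        rw [M.integral_comp_comm ((L1.integrable_coeFn b).smul_const a), integral_smul_const,
          ← augmentation_apply, hb, zero_smul, map_zero]

theorem meanCoefficient_eq_zero (hm : IsLeftInvariantMean m) (ψ : Lp ℂ 1 μ →L[ℝ] ℝ)
    (e : Lp ℂ 1 μ) {b : Lp ℂ 1 μ} (hb : augmentation μ b = 0) :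
    hm.meanCoefficient ψ e b = 0 := by
  classical
  obtain ⟨u, -, hu⟩ := exists_left_approximate_unit μ
  refine tendsto_nhds_unique
    (((hm.meanCoefficient ψ e).continuous.tendsto b).comp (tendsto_sub_nhds_zero_iff.1 (hu b))) ?_
  exact tendsto_const_nhds.congr fun n => (hm.meanCoefficient_conv_eq_zero ψ e (u n) hb).symm

theorem le_zero_of_forall_le_sum (hm : IsLeftInvariantMean m) {ι : Type*} [Fintype ι]
    (ψ : ι → Lp ℂ 1 μ →L[ℝ] ℝ) {b : ι → Lp ℂ 1 μ} (hb : ∀ i, augmentation μ (b i) = 0) {c : ℝ}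
    (hc : ∀ g ∈ probabilityDensities μ, c ≤ ∑ i, ψ i (l1Conv (b i) g)) : c ≤ 0 := by
  obtain ⟨u, hu, -⟩ := exists_left_approximate_unit μ
  obtain ⟨e, he⟩ : (probabilityDensities μ).Nonempty := ⟨u (∅, 0), hu _⟩
  calc c ≤ m (∑ i, coefficient (ψ i) e (b i)) := hm.le_apply fun x => by
        rw [AddSubmonoidClass.coe_finsetSum, Finset.sum_apply]
        exact hc _ (leftTranslate_mem_probabilityDensities x he)
    _ = 0 := by
        rw [map_sum]
        exact Finset.sum_eq_zero fun i _ => hm.meanCoefficient_eq_zero (ψ i) e (hb i)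

end IsLeftInvariantMean

end InvariantMean

section Reiter

variable {G : Type*} [Group G] [TopologicalSpace G] [IsTopologicalGroup G]
  [MeasurableSpace G] [BorelSpace G] [LocallyCompactSpace G] [T2Space G] {μ : Measure G}
  [μ.IsHaarMeasure] [μ.Regular]

theorem IsAmenableGroup.exists_norm_conv_lt (hG : IsAmenableGroup G μ) {ι : Type*} [Finite ι]
    {b : ι → Lp ℂ 1 μ} (hb : ∀ i, augmentation μ (b i) = 0) {ε : ℝ} (hε : 0 < ε) :
    ∃ g ∈ probabilityDensities μ, ∀ i, ‖l1Conv (b i) g‖ < ε := by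
  classical
  have := Fintype.ofFinite ι
  let D : Lp ℂ 1 μ →L[ℝ] (ι → Lp ℂ 1 μ) := (ContinuousLinearMap.pi fun i =>
    isContractiveFamily_leftTranslateL.integrated μ (b i)).restrictScalars ℝ
  suffices zero_mem : 0 ∈ closure (D '' probabilityDensities μ) by
    obtain ⟨_, ⟨g, hg, rfl⟩, hgε⟩ := Metric.mem_closure_iff.1 zero_mem ε hε
    rw [dist_zero_left] at hgε
    exact ⟨g, hg, fun i => (norm_le_pi_norm (D g) i).trans_lt hgε⟩
  by_contra zero_notMem
  obtain ⟨f, c, hc, hf⟩ := geometric_hahn_banach_point_closed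
    (convex_probabilityDensities.linear_image D.toLinearMap).closure isClosed_closure zero_notMem
  rw [map_zero] at hc
  obtain ⟨m, h1, hpos, hinv⟩ := hG
  refine hc.not_ge (IsLeftInvariantMean.le_zero_of_forall_le_sum ⟨h1, hpos, hinv⟩
    (fun i => f.comp (.single ℝ (fun _ => Lp ℂ 1 μ) i)) hb fun g hg => ?_)
  exact (hf _ (subset_closure ⟨g, hg, rfl⟩)).le.trans_eq
    (ContinuousLinearMap.sum_comp_single ℝ (fun _ => Lp ℂ 1 μ) f (D g)).symm

theorem IsAmenableGroup.exists_net_tendsto_conv (hG : IsAmenableGroup G μ) :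
    ∃ g : Finset {b : Lp ℂ 1 μ // augmentation μ b = 0} × ℕ → Lp ℂ 1 μ,
      (∀ n, g n ∈ probabilityDensities μ) ∧
        ∀ b, augmentation μ b = 0 → Tendsto (fun n => l1Conv b (g n)) atTop (𝓝 0) := by
  obtain ⟨g, hg, hgb⟩ := exists_net_tendsto_zero (P := (· ∈ probabilityDensities μ))
    (F := fun (b : {b : Lp ℂ 1 μ // augmentation μ b = 0}) g => l1Conv b.1 g) fun S ε hε => by
      obtain ⟨g, hg, hgb⟩ := hG.exists_norm_conv_lt (b := fun i : S => i.1.1) (fun i => i.1.2) hε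
      exact ⟨g, hg, fun b hb => hgb ⟨b, hb⟩⟩
  exact ⟨g, hg, fun b hb => hgb ⟨b, hb⟩⟩

theorem norm_convRightL_le (g : Lp ℂ 1 μ) : ‖convRightL g‖ ≤ ‖g‖ :=
  LinearMap.mkContinuous_norm_le _ (norm_nonneg _) _

theorem IsAmenableGroup.exists_net_tendsto_integral_leftTranslate_sub (hG : IsAmenableGroup G μ) :
    ∃ f : Finset {b : Lp ℂ 1 μ // augmentation μ b = 0} × ℕ → Lp ℂ 1 μ,
      (∀ n, f n ∈ probabilityDensities μ) ∧
        ∀ a : Lp ℂ 1 μ,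
          Tendsto (fun n => ∫ w, ‖a w‖ * ‖leftTranslate w (f n) - f n‖ ∂μ) atTop (𝓝 0) := by
  obtain ⟨g, hg, hgb⟩ := hG.exists_net_tendsto_conv
  obtain ⟨u, hu, -⟩ := exists_left_approximate_unit μ
  set e := u (∅, 0)
  have leftTranslate_conv_sub (n) (w : G) : leftTranslate w (l1Conv e (g n)) - l1Conv e (g n) =
      convRightL (g n) (leftTranslate w e - e) := by
    rw [map_sub, ← conv_leftTranslate]
    rfl
  refine ⟨fun n => l1Conv e (g n), fun n => conv_mem_probabilityDensities (hu _) (hg n),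
    fun a => ?_⟩
  simp only [leftTranslate_conv_sub]
  refine tendsto_integral_norm_mul_norm_apply (M := 1) (C := ‖e‖ + ‖e‖)
    (fun n => (norm_convRightL_le _).trans (hg n).1) (L1.integrable_coeFn a)
    ((continuous_leftTranslate e).sub continuous_const) (fun w => ?_) fun w => ?_
  · exact (norm_sub_le _ _).trans_eq (by rw [norm_leftTranslate])
  · refine hgb _ ?_
    rw [map_sub, augmentation_leftTranslate, sub_self]

end Reiter

/-! ### Operators on the projective tensor square -/

namespace ProjTensorSq

variable {A : Type*} [NonUnitalNormedRing A] [NormedSpace ℂ A]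

/-- The bounded bilinear map `(a, b) ↦ a ⊗ b`. -/
def tmulL : A →L[ℂ] A →L[ℂ] ProjTensorSq A :=
  (continuousMultilinearCurryFin1 ℂ A (ProjTensorSq A)).toContinuousLinearEquiv ∘L
    (UniformSpace.Completion.toComplL.compContinuousMultilinearMap
      (PiTensorProduct.tprodL ℂ (E := fun _ : Fin 2 => A))).curryLeft

theorem tmulL_apply (a b : A) : tmulL a b = tmul a b := by
  simp [tmulL, tmul]

theorem norm_tmul_le (a b : A) : ‖(tmul a b : ProjTensorSq A)‖ ≤ ‖a‖ * ‖b‖ := by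
  rw [tmul, UniformSpace.Completion.norm_coe]
  simpa using PiTensorProduct.projectiveSeminorm_tprod_le (𝕜 := ℂ) (![a, b] : Fin 2 → A)

theorem induction_on {P : ProjTensorSq A → Prop} (s : ProjTensorSq A) (hP : IsClosed {s | P s})
    (hadd : ∀ s t, P s → P t → P (s + t)) (htmul : ∀ a b, P (tmul a b)) : P s := by
  induction s using UniformSpace.Completion.induction_on with
  | hp => exact hP
  | ih s =>
    induction s using PiTensorProduct.induction_on with
    | smul_tprod c m =>
      have absorb_scalar :
          c • PiTensorProduct.tprod ℂ m = PiTensorProduct.tprod ℂ ![c • m 0, m 1] := by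
        rw [← Fin.cons_self_tail m, ← MultilinearMap.cons_smul]
        congr 1
        funext i
        fin_cases i <;> rfl
      rw [absorb_scalar]
      exact htmul _ _
    | add x y hx hy =>
      rw [UniformSpace.Completion.coe_add]
      exact hadd _ _ hx hy

theorem ext_tmul {E : Type*} [NormedAddCommGroup E] [NormedSpace ℂ E]
    {S T : ProjTensorSq A →L[ℂ] E} (h : ∀ a b, S (tmul a b) = T (tmul a b)) : S = T := by
  refine ContinuousLinearMap.ext fun s => ?_
  induction s using ProjTensorSq.induction_on with
  | hP => exact isClosed_eq S.continuous T.continuous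
  | hadd s t hs ht => rw [map_add, map_add, hs, ht]
  | htmul a b => exact h a b

theorem norm_completion_apply_le {E F : Type*} [SeminormedAddCommGroup E] [NormedSpace ℂ E]
    [SeminormedAddCommGroup F] [NormedSpace ℂ F] (T : E →L[ℂ] F) (x : UniformSpace.Completion E) :
    ‖T.completion x‖ ≤ ‖T‖ * ‖x‖ := by
  induction x using UniformSpace.Completion.induction_on with
  | hp => exact isClosed_le (by fun_prop) (by fun_prop)
  | ih x =>
    rw [ContinuousLinearMap.completion_apply_coe, UniformSpace.Completion.norm_coe,
      UniformSpace.Completion.norm_coe]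
    exact T.le_opNorm x

/-- The tensor product `S ⊗ T` of two operators, acting on `A ⊗̂ A`. -/
def map (S T : A →L[ℂ] A) : ProjTensorSq A →L[ℂ] ProjTensorSq A :=
  (PiTensorProduct.mapL (![S, T] : Fin 2 → (A →L[ℂ] A))).completion

theorem map_tmul (S T : A →L[ℂ] A) (a b : A) : map S T (tmul a b) = tmul (S a) (T b) := by
  simp only [map, tmul, ContinuousLinearMap.completion_apply_coe, PiTensorProduct.mapL_apply,
    PiTensorProduct.map_tprod]
  congr 2
  funext i
  fin_cases i <;> rfl

theorem norm_map_apply_le (S T : A →L[ℂ] A) (s : ProjTensorSq A) :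
    ‖map S T s‖ ≤ ‖S‖ * ‖T‖ * ‖s‖ := by
  refine (norm_completion_apply_le _ s).trans ?_
  refine mul_le_mul_of_nonneg_right ((PiTensorProduct.opNorm_mapL _).trans_eq ?_) (norm_nonneg _)
  simp

theorem map_map (S S' T T' : A →L[ℂ] A) (s : ProjTensorSq A) :
    map S T (map S' T' s) = map (S ∘L S') (T ∘L T') s := by
  have comp_eq : map S T ∘L map S' T' = map (S ∘L S') (T ∘L T') :=
    ext_tmul fun a b => by simp only [ContinuousLinearMap.comp_apply, map_tmul]
  exact DFunLike.congr_fun comp_eq s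

theorem flip_map (S T : A →L[ℂ] A) (s : ProjTensorSq A) :
    flip (map S T s) = map T S (flip s) := by
  have comp_eq : (flip ∘L map S T : ProjTensorSq A →L[ℂ] ProjTensorSq A) = map T S ∘L flip :=
    ext_tmul fun a b => by simp only [ContinuousLinearMap.comp_apply, map_tmul, flip_tmul]
  exact DFunLike.congr_fun comp_eq s

section Bimodule

variable [IsScalarTower ℂ A A] [SMulCommClass ℂ A A]

theorem leftMul_eq_map (a : A) : leftMul a = map (.mul ℂ A a) (.id ℂ A) := rfl

theorem rightMul_eq_map (a : A) :
    rightMul a = map (.id ℂ A) ((ContinuousLinearMap.mul ℂ A).flip a) := rfl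

end Bimodule

end ProjTensorSq

namespace IsContractiveFamily

section Construction

variable {X : Type*} [TopologicalSpace X]

theorem id {E : Type*} [NormedAddCommGroup E] [NormedSpace ℂ E] :
    IsContractiveFamily fun _ : X => ContinuousLinearMap.id ℂ E :=
  ⟨fun _ _ => le_rfl, fun _ => continuous_const⟩

variable {A : Type*} [NonUnitalNormedRing A] [NormedSpace ℂ A]

theorem tensorMap {S T : X → A →L[ℂ] A} (hS : IsContractiveFamily S) (hT : IsContractiveFamily T) :
    IsContractiveFamily fun z => ProjTensorSq.map (S z) (T z) := by
  have norm_le_one {R : X → A →L[ℂ] A} (hR : IsContractiveFamily R) (z : X) : ‖R z‖ ≤ 1 :=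
    (R z).opNorm_le_bound zero_le_one fun x => (hR.norm_apply_le z x).trans_eq (one_mul _).symm
  have norm_map_apply_le (z : X) (s : ProjTensorSq A) :
      ‖ProjTensorSq.map (S z) (T z) s‖ ≤ ‖s‖ :=
    (ProjTensorSq.norm_map_apply_le _ _ s).trans <| mul_le_of_le_one_left (norm_nonneg _) <|
      mul_le_one₀ (norm_le_one hS z) (norm_nonneg _) (norm_le_one hT z)
  refine ⟨norm_map_apply_le, fun s => ?_⟩
  induction s using ProjTensorSq.induction_on with
  | hP =>
    exact isClosed_setOf_continuous_apply (C := 1) fun z =>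
      ContinuousLinearMap.opNorm_le_bound _ zero_le_one fun s =>
        (norm_map_apply_le z s).trans_eq (one_mul _).symm
  | hadd s t hs ht =>
    simp only [map_add]
    exact hs.add ht
  | htmul a b =>
    simp only [ProjTensorSq.map_tmul]
    simp only [← ProjTensorSq.tmulL_apply]
    exact ProjTensorSq.tmulL.continuous₂.comp
      ((hS.continuous_apply a).prodMk (hT.continuous_apply b))

end Construction

variable {X : Type*} [TopologicalSpace X] [T2Space X] [LocallyCompactSpace X] [MeasurableSpace X]
  [BorelSpace X] {μ : Measure X} [μ.Regular]

section Intertwine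

variable {E F : Type*} [NormedAddCommGroup E] [NormedSpace ℂ E] [CompleteSpace E]
  [NormedAddCommGroup F] [NormedSpace ℂ F] [CompleteSpace F]

theorem map_integrated_of_intertwine {T : X → E →L[ℂ] E} {T' : X → F →L[ℂ] F}
    (hT : IsContractiveFamily T) (hT' : IsContractiveFamily T') (S : E →L[ℂ] F)
    (h : ∀ y v, S (T y v) = T' y (S v)) (f : Lp ℂ 1 μ) (v : E) :
    S (hT.integrated μ f v) = hT'.integrated μ f (S v) := by
  simp only [hT.map_integrated, h, hT'.integrated_apply]

theorem integrated_integrated_comm {T T' : X → E →L[ℂ] E} (hT : IsContractiveFamily T)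
    (hT' : IsContractiveFamily T') (h : ∀ x y v, T x (T' y v) = T' y (T x v))
    (f g : Lp ℂ 1 μ) (v : E) :
    hT.integrated μ f (hT'.integrated μ g v) = hT'.integrated μ g (hT.integrated μ f v) :=
  hT'.map_integrated_of_intertwine hT' (hT.integrated μ f)
    (fun y _ => (hT.map_integrated_of_intertwine hT (T' y) (fun x w => (h x y w).symm) f _).symm)
    g v

end Intertwine

section Tensor

variable {A : Type*} [NonUnitalNormedRing A] [NormedSpace ℂ A] [CompleteSpace A]

theorem map_integrated_id {T : X → A →L[ℂ] A} (hT : IsContractiveFamily T) (f : Lp ℂ 1 μ) :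
    ProjTensorSq.map (hT.integrated μ f) (.id ℂ A) = (hT.tensorMap id).integrated μ f :=
  ProjTensorSq.ext_tmul fun a b => by
    rw [ProjTensorSq.map_tmul, integrated_apply, ← ProjTensorSq.tmulL_apply]
    refine (hT.map_integrated (ProjTensorSq.tmulL.flip b) f a).trans
      (integral_congr_ae (ae_of_all _ fun y => ?_))
    simp only [ContinuousLinearMap.flip_apply, ProjTensorSq.tmulL_apply, ProjTensorSq.map_tmul,
      ContinuousLinearMap.id_apply]

theorem map_id_integrated {T : X → A →L[ℂ] A} (hT : IsContractiveFamily T) (f : Lp ℂ 1 μ) :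
    ProjTensorSq.map (.id ℂ A) (hT.integrated μ f) = (id.tensorMap hT).integrated μ f :=
  ProjTensorSq.ext_tmul fun a b => by
    rw [ProjTensorSq.map_tmul, integrated_apply, ← ProjTensorSq.tmulL_apply]
    refine (hT.map_integrated (ProjTensorSq.tmulL a) f b).trans
      (integral_congr_ae (ae_of_all _ fun y => ?_))
    simp only [ProjTensorSq.tmulL_apply, ProjTensorSq.map_tmul, ContinuousLinearMap.id_apply]

end Tensor

end IsContractiveFamily

/-! ### Averaged tensors over the group algebra -/

namespace GroupL1

variable {G : Type*} [Group G] [TopologicalSpace G] [IsTopologicalGroup G]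
  [MeasurableSpace G] [BorelSpace G] [LocallyCompactSpace G] [T2Space G]
  {μ : Measure G} [μ.IsHaarMeasure] [μ.Regular]

section Translation

/-- An element of the group algebra as an element of the underlying space `L¹(G)`. -/
def toLp (a : GroupL1 G μ) : Lp ℂ 1 μ := a

variable (μ) in
/-- Left translation `a ↦ δ_y * a` of the group algebra. -/
def translateLeft (y : G) : GroupL1 G μ →L[ℂ] GroupL1 G μ := leftTranslateL μ y

variable (μ) in
/-- Right translation `a ↦ a * δ_w` of the group algebra. -/
def translateRight (w : G) : GroupL1 G μ →L[ℂ] GroupL1 G μ := rightTranslateL μ w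

theorem isContractiveFamily_translateLeft : IsContractiveFamily (translateLeft μ) :=
  isContractiveFamily_leftTranslateL (μ := μ)

theorem isContractiveFamily_translateRight : IsContractiveFamily (translateRight μ) :=
  isContractiveFamily_rightTranslateL (μ := μ)

theorem translateLeft_mul (y z : G) :
    translateLeft μ (y * z) = translateLeft μ y ∘L translateLeft μ z :=
  ContinuousLinearMap.ext (leftTranslate_mul (μ := μ) y z)

theorem translateRight_mul (y z : G) :
    translateRight μ (y * z) = translateRight μ z ∘L translateRight μ y :=
  ContinuousLinearMap.ext (rightTranslate_mul (μ := μ) y z)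

theorem translateRight_comp_translateLeft (w y : G) :
    translateRight μ w ∘L translateLeft μ y = translateLeft μ y ∘L translateRight μ w :=
  ContinuousLinearMap.ext (rightTranslate_leftTranslate (μ := μ) w y)

theorem translateLeft_one : translateLeft μ (1 : G) = .id ℂ (GroupL1 G μ) :=
  ContinuousLinearMap.ext (leftTranslate_one (μ := μ))

theorem translateLeft_translateLeft_inv (y : G) (a : GroupL1 G μ) :
    translateLeft μ y (translateLeft μ y⁻¹ a) = a := by
  rw [← ContinuousLinearMap.comp_apply, ← translateLeft_mul, mul_inv_cancel, translateLeft_one,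
    ContinuousLinearMap.id_apply]

theorem translateLeft_apply_mul (y : G) (a b : GroupL1 G μ) :
    translateLeft μ y a * b = translateLeft μ y (a * b) :=
  conv_leftTranslate (μ := μ) y a b

theorem translateRight_apply_mul (w : G) (a b : GroupL1 G μ) :
    translateRight μ w a * b = a * translateLeft μ w b :=
  rightTranslate_conv (μ := μ) w a b

theorem leftMul_eq_integrated (a : GroupL1 G μ) :
    ProjTensorSq.leftMul a =
      (isContractiveFamily_translateLeft.tensorMap .id).integrated μ (toLp a) := by
  have mul_left : ContinuousLinearMap.mul ℂ (GroupL1 G μ) a =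
      isContractiveFamily_translateLeft.integrated μ (toLp a) :=
    ContinuousLinearMap.ext fun b => conv_eq_integrated_left (μ := μ) a b
  rw [ProjTensorSq.leftMul_eq_map, mul_left, IsContractiveFamily.map_integrated_id]

theorem rightMul_eq_integrated (a : GroupL1 G μ) :
    ProjTensorSq.rightMul a =
      (IsContractiveFamily.id.tensorMap isContractiveFamily_translateRight).integrated μ
        (toLp a) := by
  have mul_right : (ContinuousLinearMap.mul ℂ (GroupL1 G μ)).flip a =
      isContractiveFamily_translateRight.integrated μ (toLp a) :=
    ContinuousLinearMap.ext fun b => conv_eq_integrated_right (μ := μ) b a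
  rw [ProjTensorSq.rightMul_eq_map, mul_right, IsContractiveFamily.map_id_integrated]

end Translation

section Average

open ProjTensorSq

variable (μ) in
/-- The operators `b ⊗ c ↦ δ_z * b ⊗ c * δ_{z⁻¹}`. -/
def outerTranslate (z : G) : ProjTensorSq (GroupL1 G μ) →L[ℂ] ProjTensorSq (GroupL1 G μ) :=
  ProjTensorSq.map (translateLeft μ z) (translateRight μ z⁻¹)

variable (μ) in
/-- The operators `b ⊗ c ↦ b * δ_{y⁻¹} ⊗ δ_y * c`, which do not change the product `bc`. -/
def innerTranslate (y : G) : ProjTensorSq (GroupL1 G μ) →L[ℂ] ProjTensorSq (GroupL1 G μ) :=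
  ProjTensorSq.map (translateRight μ y⁻¹) (translateLeft μ y)

theorem isContractiveFamily_outerTranslate : IsContractiveFamily (outerTranslate μ) :=
  isContractiveFamily_translateLeft.tensorMap
    (isContractiveFamily_translateRight.comp continuous_inv)

theorem isContractiveFamily_innerTranslate : IsContractiveFamily (innerTranslate μ) :=
  (isContractiveFamily_translateRight.comp continuous_inv).tensorMap
    isContractiveFamily_translateLeft

theorem outerTranslate_innerTranslate_comm (z y : G) (s : ProjTensorSq (GroupL1 G μ)) :
    outerTranslate μ z (innerTranslate μ y s) = innerTranslate μ y (outerTranslate μ z s) := by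
  rw [outerTranslate, innerTranslate, ProjTensorSq.map_map, ProjTensorSq.map_map,
    translateRight_comp_translateLeft, translateRight_comp_translateLeft]

variable (μ) in
/-- The average `∫ f(z) (δ_z ⊗ δ_{z⁻¹}) dz` of the outer translations. -/
def outerAverage (f : Lp ℂ 1 μ) :
    ProjTensorSq (GroupL1 G μ) →L[ℂ] ProjTensorSq (GroupL1 G μ) :=
  isContractiveFamily_outerTranslate.integrated μ f

variable (μ) in
/-- The average `∫ f(y) (δ_{y⁻¹} ⊗ δ_y) dy` of the inner translations. -/
def innerAverage (f : Lp ℂ 1 μ) :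
    ProjTensorSq (GroupL1 G μ) →L[ℂ] ProjTensorSq (GroupL1 G μ) :=
  isContractiveFamily_innerTranslate.integrated μ f

theorem flip_outerAverage (f : Lp ℂ 1 μ) (s : ProjTensorSq (GroupL1 G μ)) :
    flip (outerAverage μ f s) = innerAverage μ f (flip s) :=
  isContractiveFamily_outerTranslate.map_integrated_of_intertwine
    isContractiveFamily_innerTranslate flip (fun _ => flip_map _ _) f s

theorem flip_innerAverage (f : Lp ℂ 1 μ) (s : ProjTensorSq (GroupL1 G μ)) :
    flip (innerAverage μ f s) = outerAverage μ f (flip s) :=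
  isContractiveFamily_innerTranslate.map_integrated_of_intertwine
    isContractiveFamily_outerTranslate flip (fun _ => flip_map _ _) f s

theorem flip_outerAverage_innerAverage {f : Lp ℂ 1 μ} {s : ProjTensorSq (GroupL1 G μ)}
    (hs : flip s = s) :
    flip (outerAverage μ f (innerAverage μ f s)) = outerAverage μ f (innerAverage μ f s) := by
  rw [flip_outerAverage, flip_innerAverage, hs]
  exact isContractiveFamily_innerTranslate.integrated_integrated_comm
    isContractiveFamily_outerTranslate
    (fun _ _ _ => (outerTranslate_innerTranslate_comm _ _ _).symm) f f s

theorem map_translateLeft_id_outerAverage (w : G) (f : Lp ℂ 1 μ)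
    (s : ProjTensorSq (GroupL1 G μ)) :
    ProjTensorSq.map (translateLeft μ w) (.id ℂ _) (outerAverage μ f s) =
      ProjTensorSq.map (.id ℂ _) (translateRight μ w) (outerAverage μ (leftTranslate w f) s) := by
  rw [outerAverage, outerAverage, IsContractiveFamily.map_integrated,
    IsContractiveFamily.map_integrated,
    ← integral_mul_left_eq_self (fun z => leftTranslate w f z • _) w]
  refine integral_congr_ae ?_
  filter_upwards [(measurePreserving_mul_left μ w).quasiMeasurePreserving.ae
    (coeFn_leftTranslate w f)] with z hz
  rw [hz, inv_mul_cancel_left]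
  simp only [outerTranslate, ProjTensorSq.map_map, ContinuousLinearMap.id_comp, ← translateLeft_mul,
    ← translateRight_mul, mul_inv_rev, inv_mul_cancel_right]

theorem norm_leftMul_sub_rightMul_outerAverage_le (a : GroupL1 G μ) (f : Lp ℂ 1 μ)
    (s : ProjTensorSq (GroupL1 G μ)) :
    ‖leftMul a (outerAverage μ f s) - rightMul a (outerAverage μ f s)‖ ≤
      (∫ w, ‖toLp a w‖ * ‖leftTranslate w f - f‖ ∂μ) * ‖s‖ := by
  have hL : IsContractiveFamily fun w =>
      ProjTensorSq.map (translateLeft μ w) (.id ℂ (GroupL1 G μ)) :=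
    isContractiveFamily_translateLeft.tensorMap .id
  have hR : IsContractiveFamily fun w =>
      ProjTensorSq.map (.id ℂ (GroupL1 G μ)) (translateRight μ w) :=
    IsContractiveFamily.id.tensorMap isContractiveFamily_translateRight
  have integrable_bound : Integrable (fun w => ‖toLp a w‖ * ‖leftTranslate w f - f‖) μ := by
    have := (integrable_smul_of_continuous_of_norm_le (L1.integrable_coeFn (toLp a))
      ((continuous_leftTranslate f).sub continuous_const) fun w =>
        (norm_sub_le (leftTranslate w f) f).trans_eq (by rw [norm_leftTranslate])).norm
    simpa only [norm_smul, Pi.sub_apply] using this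
  rw [leftMul_eq_integrated, rightMul_eq_integrated, IsContractiveFamily.integrated_apply,
    IsContractiveFamily.integrated_apply, ← integral_sub (hL.integrable _ _) (hR.integrable _ _),
    ← integral_mul_const]
  refine norm_integral_le_of_norm_le (integrable_bound.mul_const _) (ae_of_all _ fun w => ?_)
  have translate_sub : ProjTensorSq.map (translateLeft μ w) (.id ℂ _) (outerAverage μ f s) -
      ProjTensorSq.map (.id ℂ _) (translateRight μ w) (outerAverage μ f s) =
        ProjTensorSq.map (.id ℂ _) (translateRight μ w)
          (outerAverage μ (leftTranslate w f - f) s) := by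
    rw [map_translateLeft_id_outerAverage, ← map_sub]
    congr 1
    rw [outerAverage, outerAverage, outerAverage, map_sub, sub_apply]
  rw [← smul_sub, translate_sub, norm_smul, mul_assoc]
  exact mul_le_mul_of_nonneg_left ((hR.norm_apply_le w _).trans
    (isContractiveFamily_outerTranslate.norm_integrated_apply_le _ _)) (norm_nonneg _)

theorem prod_outerTranslate_mul (z : G) (s : ProjTensorSq (GroupL1 G μ)) (a : GroupL1 G μ) :
    prod (outerTranslate μ z s) * a = translateLeft μ z (prod s * translateLeft μ z⁻¹ a) := by
  have comp_eq : (ContinuousLinearMap.mul ℂ (GroupL1 G μ)).flip a ∘L prod ∘L outerTranslate μ z =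
      translateLeft μ z ∘L
        (ContinuousLinearMap.mul ℂ (GroupL1 G μ)).flip (translateLeft μ z⁻¹ a) ∘L prod :=
    ext_tmul fun b c => by
      simp only [ContinuousLinearMap.comp_apply, ContinuousLinearMap.flip_apply,
        ContinuousLinearMap.mul_apply', outerTranslate, map_tmul, prod_tmul, mul_assoc,
        translateRight_apply_mul, translateLeft_apply_mul]
  exact DFunLike.congr_fun comp_eq s

theorem prod_innerTranslate (y : G) (s : ProjTensorSq (GroupL1 G μ)) :
    prod (innerTranslate μ y s) = prod s := by
  have comp_eq : prod ∘L innerTranslate μ y = (prod : ProjTensorSq (GroupL1 G μ) →L[ℂ] _) :=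
    ext_tmul fun b c => by
      have inv_cancel : translateLeft μ y⁻¹ (translateLeft μ y c) = c := by
        simpa only [inv_inv] using translateLeft_translateLeft_inv y⁻¹ c
      rw [ContinuousLinearMap.comp_apply, innerTranslate, map_tmul, prod_tmul, prod_tmul,
        translateRight_apply_mul, inv_cancel]
  exact DFunLike.congr_fun comp_eq s

theorem prod_innerAverage (f : Lp ℂ 1 μ) (s : ProjTensorSq (GroupL1 G μ)) :
    prod (innerAverage μ f s) = augmentation μ f • prod s := by
  rw [innerAverage, IsContractiveFamily.map_integrated]
  simp only [prod_innerTranslate]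
  rw [integral_smul_const, augmentation_apply]

theorem norm_prod_outerAverage_mul_sub_le {f : Lp ℂ 1 μ} (hf : augmentation μ f = 1)
    (s : ProjTensorSq (GroupL1 G μ)) (a : GroupL1 G μ) :
    ‖prod (outerAverage μ f s) * a - a‖ ≤
      ∫ z, ‖f z‖ * ‖prod s * translateLeft μ z⁻¹ a - translateLeft μ z⁻¹ a‖ ∂μ := by
  refine ((isContractiveFamily_outerTranslate (μ := μ)).norm_map_integrated_sub_le hf
    ((ContinuousLinearMap.mul ℂ (GroupL1 G μ)).flip a ∘L prod) s a).trans_eq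
    (integral_congr_ae (ae_of_all _ fun z => congrArg (‖f z‖ * ·) ?_))
  calc ‖prod (outerTranslate μ z s) * a - a‖
      = ‖translateLeft μ z (prod s * translateLeft μ z⁻¹ a - translateLeft μ z⁻¹ a)‖ := by
        rw [prod_outerTranslate_mul, map_sub, translateLeft_translateLeft_inv]
    _ = ‖prod s * translateLeft μ z⁻¹ a - translateLeft μ z⁻¹ a‖ :=
        norm_leftTranslate (μ := μ) z _

end Average

end GroupL1

theorem tendsto_mul_self_mul_sub {Λ A : Type*} [NonUnitalNormedRing A] {l : Filter Λ} {u : Λ → A}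
    (hu : ∀ i, ‖u i‖ ≤ 1) {a : A} (ha : Tendsto (fun i => u i * a - a) l (𝓝 0)) :
    Tendsto (fun i => u i * u i * a - a) l (𝓝 0) := by
  have norm_mul_le_norm (i : Λ) : ‖u i * (u i * a - a)‖ ≤ ‖u i * a - a‖ :=
    (norm_mul_le _ _).trans (mul_le_of_le_one_left (norm_nonneg _) (hu i))
  have sum_tendsto :=
    (squeeze_zero_norm norm_mul_le_norm (tendsto_zero_iff_norm_tendsto_zero.1 ha)).add ha
  rw [add_zero] at sum_tendsto
  refine sum_tendsto.congr fun i => ?_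
  rw [mul_sub, mul_assoc, sub_add_sub_cancel]

namespace GroupL1

open ProjTensorSq

variable {G : Type*} [Group G] [TopologicalSpace G] [IsTopologicalGroup G]
  [MeasurableSpace G] [BorelSpace G] [LocallyCompactSpace G] [T2Space G]
  {μ : Measure G} [μ.IsHaarMeasure] [μ.Regular]

theorem exists_contractive_approximate_unit :
    ∃ u : Finset (GroupL1 G μ) × ℕ → GroupL1 G μ,
      (∀ n, ‖u n‖ ≤ 1) ∧ ∀ a, Tendsto (fun n => u n * a - a) atTop (𝓝 0) := by
  obtain ⟨u, hu, hua⟩ := exists_left_approximate_unit μ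
  exact ⟨u, fun n => (hu n).1, hua⟩

theorem tendsto_integral_mul_self_mul_translateLeft_sub {Λ : Type*} {l : Filter Λ}
    {u : Λ → GroupL1 G μ} (hu : ∀ i, ‖u i‖ ≤ 1)
    (hua : ∀ a, Tendsto (fun i => u i * a - a) l (𝓝 0)) (f : Lp ℂ 1 μ) (a : GroupL1 G μ) :
    Tendsto (fun i => ∫ z, ‖f z‖ *
      ‖u i * u i * translateLeft μ z⁻¹ a - translateLeft μ z⁻¹ a‖ ∂μ) l (𝓝 0) := by
  let T (i : Λ) : GroupL1 G μ →L[ℂ] GroupL1 G μ := .mul ℂ _ (u i * u i) - .id ℂ _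
  have norm_T_le (i : Λ) : ‖T i‖ ≤ 1 + 1 := by
    refine (norm_sub_le _ _).trans (add_le_add ?_ ContinuousLinearMap.norm_id_le)
    exact (ContinuousLinearMap.opNorm_mul_apply_le ℂ _ _).trans <|
      (norm_mul_le _ _).trans (mul_le_one₀ (hu i) (norm_nonneg _) (hu i))
  have inv_translates := isContractiveFamily_translateLeft (μ := μ).comp continuous_inv
  exact tendsto_integral_norm_mul_norm_apply norm_T_le (L1.integrable_coeFn f)
    (inv_translates.continuous_apply a) (fun z => inv_translates.norm_apply_le z a)
    fun z => tendsto_mul_self_mul_sub hu (hua _)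

theorem norm_leftMul_sub_rightMul_outerAverage_innerAverage_le (a : GroupL1 G μ) {f : Lp ℂ 1 μ}
    (hf : ‖f‖ ≤ 1) {u : GroupL1 G μ} (hu : ‖u‖ ≤ 1) :
    ‖leftMul a (outerAverage μ f (innerAverage μ f (tmul u u))) -
      rightMul a (outerAverage μ f (innerAverage μ f (tmul u u)))‖ ≤
        ∫ w, ‖toLp a w‖ * ‖leftTranslate w f - f‖ ∂μ := by
  refine (norm_leftMul_sub_rightMul_outerAverage_le a f _).trans
    (mul_le_of_le_one_right (integral_nonneg fun w => by positivity) ?_)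
  calc ‖innerAverage μ f (tmul u u)‖ ≤ ‖f‖ * ‖(tmul u u : ProjTensorSq (GroupL1 G μ))‖ :=
        isContractiveFamily_innerTranslate.norm_integrated_apply_le _ _
    _ ≤ 1 := mul_le_one₀ hf (norm_nonneg _) <|
        (norm_tmul_le u u).trans (mul_le_one₀ hu (norm_nonneg _) hu)

theorem exists_flip_eq_norm_lt (hG : IsAmenableGroup G μ) (S : Finset (GroupL1 G μ)) {ε : ℝ}
    (hε : 0 < ε) : ∃ t : ProjTensorSq (GroupL1 G μ), flip t = t ∧
      ∀ a ∈ S, ‖(leftMul a t - rightMul a t, prod t * a - a)‖ < ε := by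
  classical
  obtain ⟨f, hf, hfa⟩ := hG.exists_net_tendsto_integral_leftTranslate_sub
  obtain ⟨u, hu, hua⟩ := exists_contractive_approximate_unit (μ := μ)
  obtain ⟨n, hn⟩ := ((Finset.eventually_all S).2 fun a _ =>
    (hfa (toLp a)).eventually_lt_const hε).exists
  obtain ⟨m, hm⟩ := ((Finset.eventually_all S).2 fun a _ =>
    (tendsto_integral_mul_self_mul_translateLeft_sub hu hua (f n) a).eventually_lt_const hε).exists
  refine ⟨outerAverage μ (f n) (innerAverage μ (f n) (tmul (u m) (u m))),
    flip_outerAverage_innerAverage (flip_tmul _ _), fun a ha => max_lt ?_ ?_⟩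
  · exact (norm_leftMul_sub_rightMul_outerAverage_innerAverage_le a (hf n).1 (hu m)).trans_lt
      (hn a ha)
  · refine (norm_prod_outerAverage_mul_sub_le (hf n).2 _ a).trans_lt ?_
    rw [prod_innerAverage, (hf n).2, one_smul, prod_tmul]
    exact hm a ha

theorem isSymmetricallyPseudoAmenable_of_isAmenableGroup (hG : IsAmenableGroup G μ) :
    IsSymmetricallyPseudoAmenable (GroupL1 G μ) := by
  classical
  obtain ⟨t, ht, hdiag⟩ := exists_net_tendsto_zero
    (F := fun a t => (leftMul a t - rightMul a t, prod t * a - a))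
    fun S ε hε => exists_flip_eq_norm_lt hG S hε
  refine ⟨Finset (GroupL1 G μ) × ℕ, inferInstance, inferInstance, inferInstance, t,
    fun a => ⟨?_, ?_⟩, ht⟩
  · exact (continuous_fst.tendsto _).comp (hdiag a)
  · exact tendsto_sub_nhds_zero_iff.1 ((continuous_snd.tendsto _).comp (hdiag a))

end GroupL1

/-! ### Slices of approximate diagonals and means -/

namespace ProjTensorSq

variable {A : Type*} [NonUnitalNormedRing A] [NormedSpace ℂ A]

/-- The bounded linear map on `A ⊗̂ A` that extends a bounded bilinear map on `A`. -/
def lift {E : Type*} [NormedAddCommGroup E] [NormedSpace ℂ E] [CompleteSpace E]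
    (B : A →L[ℂ] A →L[ℂ] E) : ProjTensorSq A →L[ℂ] E :=
  (PiTensorProduct.liftIsometry ℂ (fun _ : Fin 2 => A) E
    (((continuousMultilinearCurryFin1 ℂ A E).symm.toContinuousLinearEquiv :
      (A →L[ℂ] E) →L[ℂ] _) ∘L B).uncurryLeft).fromCompletion

theorem lift_tmul {E : Type*} [NormedAddCommGroup E] [NormedSpace ℂ E] [CompleteSpace E]
    (B : A →L[ℂ] A →L[ℂ] E) (a b : A) : lift B (tmul a b) = B a b := by
  simp [lift, tmul]

variable [CompleteSpace A]

/-- The slice map `a ⊗ b ↦ χ(b) a` of a functional `χ`. -/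
def slice (χ : A →L[ℂ] ℂ) : ProjTensorSq A →L[ℂ] A :=
  lift (ContinuousLinearMap.smulRightL ℂ A A χ)

theorem slice_tmul (χ : A →L[ℂ] ℂ) (a b : A) : slice χ (tmul a b) = χ b • a :=
  lift_tmul _ a b

variable [IsScalarTower ℂ A A] [SMulCommClass ℂ A A]

theorem slice_leftMul (χ : A →L[ℂ] ℂ) (a : A) (s : ProjTensorSq A) :
    slice χ (leftMul a s) = a * slice χ s := by
  have comp_eq : slice χ ∘L leftMul a = ContinuousLinearMap.mul ℂ A a ∘L slice χ :=
    ext_tmul fun b c => by simp [leftMul_tmul, slice_tmul]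
  exact DFunLike.congr_fun comp_eq s

variable {χ : A →L[ℂ] ℂ}

theorem slice_rightMul (hχ : ∀ a b, χ (a * b) = χ a * χ b) (a : A) (s : ProjTensorSq A) :
    slice χ (rightMul a s) = χ a • slice χ s := by
  have comp_eq : slice χ ∘L rightMul a = χ a • slice χ :=
    ext_tmul fun b c => by simp [rightMul_tmul, slice_tmul, hχ, mul_smul, smul_comm (χ a)]
  exact DFunLike.congr_fun comp_eq s

theorem apply_slice (hχ : ∀ a b, χ (a * b) = χ a * χ b) (s : ProjTensorSq A) :
    χ (slice χ s) = χ (prod s) := by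
  have comp_eq : χ ∘L slice χ = χ ∘L prod :=
    ext_tmul fun b c => by simp [prod_tmul, slice_tmul, hχ, mul_comm]
  exact DFunLike.congr_fun comp_eq s

end ProjTensorSq

namespace IsApproximateDiagonal

open ProjTensorSq

variable {A : Type*} [NonUnitalNormedRing A] [NormedSpace ℂ A] [IsScalarTower ℂ A A]
  [SMulCommClass ℂ A A] [CompleteSpace A] {Λ : Type*} [Preorder Λ] {t : Λ → ProjTensorSq A}
  {χ : A →L[ℂ] ℂ}

theorem tendsto_mul_slice_sub (ht : IsApproximateDiagonal t)
    (hχ : ∀ a b, χ (a * b) = χ a * χ b) (a : A) :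
    Tendsto (fun i => a * slice χ (t i) - χ a • slice χ (t i)) atTop (𝓝 0) := by
  simpa only [Function.comp_def, map_sub, slice_leftMul, slice_rightMul hχ, map_zero] using
    ((slice χ).continuous.tendsto 0).comp (ht a).1

theorem tendsto_apply_slice (ht : IsApproximateDiagonal t) (hχ : ∀ a b, χ (a * b) = χ a * χ b)
    {e : A} (he : χ e = 1) : Tendsto (fun i => χ (slice χ (t i))) atTop (𝓝 1) := by
  simpa only [Function.comp_def, hχ, he, mul_one, apply_slice hχ] using
    (χ.continuous.tendsto e).comp (ht e).2

end IsApproximateDiagonal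

theorem exists_linearMap_tendsto_ultrafilter {Λ V : Type*} [AddCommGroup V] [Module ℝ V]
    (U : Ultrafilter Λ) {M : Λ → V →ₗ[ℝ] ℝ} (hM : ∀ v, ∃ C, ∀ᶠ i in (U : Filter Λ), |M i v| ≤ C) :
    ∃ m : V →ₗ[ℝ] ℝ, ∀ v, Tendsto (fun i => M i v) U (𝓝 (m v)) := by
  have exists_limit (v : V) : ∃ r, Tendsto (fun i => M i v) U (𝓝 r) := by
    obtain ⟨C, hC⟩ := hM v
    obtain ⟨r, -, hr⟩ := (isCompact_Icc (a := -C) (b := C)).ultrafilter_le_nhds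
      (U.map fun i => M i v) (le_principal_iff.2 (hC.mono fun i hi => abs_le.1 hi))
    exact ⟨r, hr⟩
  choose m hm using exists_limit
  exact ⟨linearMapOfTendsto m M (tendsto_pi_nhds.2 hm), hm⟩

theorem isAmenableGroup_of_tendsto_translate_sub {G : Type*} [Group G] [TopologicalSpace G]
    [IsTopologicalGroup G] [MeasurableSpace G] [BorelSpace G] {μ : Measure G}
    [μ.IsMulLeftInvariant] {Λ : Type*} {l : Filter Λ} [l.NeBot] {M : Λ → LInftyFun μ →ₗ[ℝ] ℝ}
    (one : ∀ᶠ i in l, M i (LInftyFun.one μ) = 1)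
    (nonneg : ∀ i (h : LInftyFun μ),
      (∀ K, IsCompact K → ∀ᵐ x ∂μ.restrict K, 0 ≤ h.1 x) → 0 ≤ M i h)
    (translate : ∀ x h, Tendsto (fun i => M i (LInftyFun.translate x h) - M i h) l (𝓝 0)) :
    IsAmenableGroup G μ := by
  have hU : (Ultrafilter.of l : Filter Λ) ≤ l := Ultrafilter.of_le l
  obtain ⟨m, hm⟩ := exists_linearMap_tendsto_ultrafilter (Ultrafilter.of l) (M := M) fun h => by
    obtain ⟨C, hC⟩ := h.2.2
    refine ⟨C, ?_⟩
    filter_upwards [hU one] with i hi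
    exact (LInftyFun.abs_apply_le (nonneg i) hC).trans_eq (by rw [hi, mul_one])
  refine ⟨m, ?_, fun h hh => ge_of_tendsto' (hm h) fun i => nonneg i h hh, fun x h => ?_⟩
  · exact tendsto_nhds_unique_of_eventuallyEq (hm _) tendsto_const_nhds (hU one)
  · exact sub_eq_zero.1 (tendsto_nhds_unique ((hm _).sub (hm h)) ((translate x h).mono_left hU))

namespace LInftyFun

section NormIntegral

variable {X : Type*} [TopologicalSpace X] [T2Space X] [LocallyCompactSpace X] [MeasurableSpace X]
  [BorelSpace X] {μ : Measure X} [μ.Regular] {E : Type*} [NormedAddCommGroup E]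

theorem integrable_mul {f : X → ℝ} (hf : Integrable f μ) (h : LInftyFun μ) :
    Integrable (fun x => f x * h.1 x) μ := by
  obtain ⟨hh, C, hC⟩ := h.2
  exact integrable_smul_of_ae_restrict_isCompact_bound hf
    (fun K hK => (hh K hK).aestronglyMeasurable) hC

/-- The functional `h ↦ ∫ ‖f‖ h` on `L^∞`. -/
def normIntegral (f : Lp E 1 μ) : LInftyFun μ →ₗ[ℝ] ℝ where
  toFun h := ∫ x, ‖f x‖ * h.1 x ∂μ
  map_add' h k := by
    rw [← integral_add (integrable_mul (L1.integrable_coeFn f).norm h)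
      (integrable_mul (L1.integrable_coeFn f).norm k)]
    exact integral_congr_ae (ae_of_all _ fun x => mul_add _ _ _)
  map_smul' c h := by
    rw [RingHom.id_apply, smul_eq_mul, ← integral_const_mul]
    exact integral_congr_ae (ae_of_all _ fun x => mul_left_comm _ _ _)

theorem normIntegral_apply (f : Lp E 1 μ) (h : LInftyFun μ) :
    normIntegral f h = ∫ x, ‖f x‖ * h.1 x ∂μ := rfl

theorem normIntegral_one (f : Lp E 1 μ) : normIntegral f (one μ) = ‖f‖ := by
  rw [L1.norm_eq_integral_norm]
  exact integral_congr_ae (ae_of_all _ fun x => mul_one _)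

theorem normIntegral_nonneg (f : Lp E 1 μ) {h : LInftyFun μ}
    (hh : ∀ K, IsCompact K → ∀ᵐ x ∂μ.restrict K, 0 ≤ h.1 x) : 0 ≤ normIntegral f h := by
  refine integral_nonneg_of_ae ?_
  filter_upwards [ae_of_forall_isCompact_ae_restrict (L1.integrable_coeFn f).norm hh] with x hx
  rcases hx with hx | hx
  · exact (mul_eq_zero_of_left hx _).ge
  · exact mul_nonneg (norm_nonneg _) hx

theorem abs_normIntegral_sub_le (f g : Lp E 1 μ) {h : LInftyFun μ} {C : ℝ}
    (hC : ∀ K, IsCompact K → ∀ᵐ x ∂μ.restrict K, |h.1 x| ≤ C) :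
    |normIntegral f h - normIntegral g h| ≤ ‖f - g‖ * C := by
  rw [normIntegral_apply, normIntegral_apply,
    ← integral_sub (integrable_mul (L1.integrable_coeFn f).norm h)
      (integrable_mul (L1.integrable_coeFn g).norm h),
    L1.norm_eq_integral_norm, ← integral_mul_const, ← Real.norm_eq_abs]
  refine norm_integral_le_of_norm_le ((L1.integrable_coeFn (f - g)).norm.mul_const C) ?_
  filter_upwards [ae_of_forall_isCompact_ae_restrict (L1.integrable_coeFn (f - g)).norm hC,
    Lp.coeFn_sub f g] with x hx hfg
  rw [← sub_mul, norm_mul, Real.norm_eq_abs (h.1 x)]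
  have abs_sub_le : ‖‖f x‖ - ‖g x‖‖ ≤ ‖(f - g) x‖ := by
    rw [hfg]
    exact abs_norm_sub_norm_le _ _
  rcases hx with hx | hx
  · rw [hx] at abs_sub_le ⊢
    rw [le_antisymm abs_sub_le (norm_nonneg _), zero_mul, zero_mul]
  · exact mul_le_mul abs_sub_le hx (abs_nonneg _) (norm_nonneg _)

end NormIntegral

theorem normIntegral_translate {G : Type*} [Group G] [TopologicalSpace G] [IsTopologicalGroup G]
    [MeasurableSpace G] [BorelSpace G] [LocallyCompactSpace G] [T2Space G] {μ : Measure G}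
    [μ.IsMulLeftInvariant] [μ.Regular] (f : Lp ℂ 1 μ) (x : G) (h : LInftyFun μ) :
    normIntegral f (translate x h) = normIntegral (leftTranslate x⁻¹ f) h := by
  rw [normIntegral_apply, normIntegral_apply, ← integral_mul_left_eq_self _ x]
  refine integral_congr_ae ?_
  filter_upwards [coeFn_leftTranslate x⁻¹ f] with y hy
  change ‖f (x * y)‖ * h.1 (x⁻¹ * (x * y)) = _
  rw [hy, inv_inv, inv_mul_cancel_left]

end LInftyFun

theorem norm_augmentation_le {X : Type*} [MeasurableSpace X] {μ : Measure X} (a : Lp ℂ 1 μ) :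
    ‖augmentation μ a‖ ≤ ‖a‖ := by
  rw [augmentation_apply, L1.norm_eq_integral_norm]
  exact norm_integral_le_integral_norm _

section InvariantNet

variable {G : Type*} [Group G] [TopologicalSpace G] [IsTopologicalGroup G]
  [MeasurableSpace G] [BorelSpace G] [LocallyCompactSpace G] [T2Space G] {μ : Measure G}
  [μ.Regular]

theorem isAmenableGroup_of_tendsto_leftTranslate_sub [μ.IsMulLeftInvariant] {Λ : Type*}
    {l : Filter Λ} [l.NeBot] {f : Λ → Lp ℂ 1 μ} {c : ℝ} (hc : 0 < c) (hfc : ∀ᶠ i in l, c ≤ ‖f i‖)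
    (hf : ∀ x : G, Tendsto (fun i => leftTranslate x (f i) - f i) l (𝓝 0)) :
    IsAmenableGroup G μ := by
  refine isAmenableGroup_of_tendsto_translate_sub (l := l)
    (M := fun i => ‖f i‖⁻¹ • LInftyFun.normIntegral (f i)) ?_ (fun i h hh => ?_) fun x h => ?_
  · filter_upwards [hfc] with i hi
    rw [LinearMap.smul_apply, LInftyFun.normIntegral_one, smul_eq_mul,
      inv_mul_cancel₀ (hc.trans_le hi).ne']
  · exact mul_nonneg (inv_nonneg.2 (norm_nonneg _)) (LInftyFun.normIntegral_nonneg (f i) hh)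
  · obtain ⟨C, hC⟩ := h.2.2
    have bound_tendsto :
        Tendsto (fun i => c⁻¹ * (‖leftTranslate x⁻¹ (f i) - f i‖ * C)) l (𝓝 0) := by
      simpa using ((hf x⁻¹).norm.mul_const C).const_mul c⁻¹
    refine squeeze_zero_norm' ?_ bound_tendsto
    filter_upwards [hfc] with i hi
    rw [LinearMap.smul_apply, LinearMap.smul_apply, ← smul_sub, LInftyFun.normIntegral_translate,
      norm_smul, norm_inv, norm_norm]
    gcongr
    exact LInftyFun.abs_normIntegral_sub_le _ _ hC

variable [μ.IsHaarMeasure]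

namespace GroupL1

open ProjTensorSq

variable (μ) in
/-- The augmentation as a character of the group algebra. -/
def augmentationCharacter : GroupL1 G μ →L[ℂ] ℂ := augmentation μ

theorem augmentationCharacter_mul (a b : GroupL1 G μ) : augmentationCharacter μ (a * b) =
    augmentationCharacter μ a * augmentationCharacter μ b :=
  augmentation_conv (μ := μ) a b

theorem augmentationCharacter_translateLeft (x : G) (a : GroupL1 G μ) :
    augmentationCharacter μ (translateLeft μ x a) = augmentationCharacter μ a :=
  augmentation_leftTranslate (μ := μ) x a

theorem exists_augmentationCharacter_eq_one :
    ∃ e : GroupL1 G μ, augmentationCharacter μ e = 1 := by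
  obtain ⟨u, hu, -⟩ := exists_left_approximate_unit μ
  exact ⟨u (∅, 0), (hu _).2⟩

theorem tendsto_translateLeft_sub {Λ : Type*} {l : Filter Λ} {f : Λ → GroupL1 G μ}
    (hf : ∀ a, Tendsto (fun i => a * f i - augmentationCharacter μ a • f i) l (𝓝 0)) (x : G) :
    Tendsto (fun i => translateLeft μ x (f i) - f i) l (𝓝 0) := by
  obtain ⟨e, he⟩ := exists_augmentationCharacter_eq_one (μ := μ)
  have translated_unit := hf (translateLeft μ x e)
  have unit_translated := ((translateLeft μ x).continuous.tendsto 0).comp (hf e)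
  rw [map_zero] at unit_translated
  refine (sub_zero (0 : GroupL1 G μ) ▸ translated_unit.sub unit_translated).congr fun i => ?_
  rw [Function.comp_apply, augmentationCharacter_translateLeft, he, one_smul, map_sub,
    translateLeft_apply_mul, sub_sub_sub_cancel_left]

theorem isAmenableGroup_of_isApproximateDiagonal {Λ : Type*} [Preorder Λ] [Nonempty Λ]
    [IsDirected Λ (· ≤ ·)] {t : Λ → ProjTensorSq (GroupL1 G μ)} (ht : IsApproximateDiagonal t) :
    IsAmenableGroup G μ := by
  let f (i : Λ) : GroupL1 G μ := slice (augmentationCharacter μ) (t i)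
  obtain ⟨e, he⟩ := exists_augmentationCharacter_eq_one (μ := μ)
  have norm_tendsto : Tendsto (fun i => ‖augmentationCharacter μ (f i)‖) atTop (𝓝 1) :=
    norm_one (α := ℂ) ▸ (ht.tendsto_apply_slice augmentationCharacter_mul he).norm
  have half_le_norm : ∀ᶠ i in atTop, (1 / 2 : ℝ) ≤ ‖f i‖ :=
    (norm_tendsto.eventually_const_lt one_half_lt_one).mono fun i hi =>
      hi.le.trans (norm_augmentation_le (toLp (f i)))
  exact isAmenableGroup_of_tendsto_leftTranslate_sub (f := fun i => toLp (f i)) one_half_pos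
    half_le_norm (tendsto_translateLeft_sub (ht.tendsto_mul_slice_sub augmentationCharacter_mul))

end GroupL1

end InvariantNet

end

theorem mainTheorem5 {G : Type*} [Group G] [TopologicalSpace G] [IsTopologicalGroup G]
    [LocallyCompactSpace G] [T2Space G] [MeasurableSpace G] [BorelSpace G]
    (μ : MeasureTheory.Measure G) [μ.IsHaarMeasure] [μ.Regular] :
    IsSymmetricallyPseudoAmenable (GroupL1 G μ) ↔ IsAmenableGroup G μ := by
  refine ⟨?_, GroupL1.isSymmetricallyPseudoAmenable_of_isAmenableGroup⟩
  rintro ⟨Λ, _, _, _, t, ht, -⟩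
  exact GroupL1.isAmenableGroup_of_isApproximateDiagonal ht
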